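/- **Setting.** Let $K$ be a (non-empty) oriented virtual link diagram, i.e. an oriented link diagram in the plane whose crossings are either classical (with over/under information) or virtual. Two diagrams are virtually equivalent if they are related by a sequence of classical and virtual Reidemeister moves. The virtual crossing number $v(K)$ is the minimum of the number of virtual crossings over all diagrams virtually equivalent to $K$. A state $S$ of $K$ is obtained by smoothing each classical crossing. The smoothing that respects the orientation has coefficient $A$ at a positive and $A^{-1}$ at a negative crossing. The other smoothing has coefficient $A^{-1}$ at a positive and $A$ at a negative crossing; it joins the two incoming ends in a cusp and the two outgoing ends in a cusp, both pointing to the centre of the crossing, and these two cusps form a c-pair. A state is a collection of $|S|$ closed loops with cusps, possibly with virtual crossings. Going along a loop, two consecutive cusps that point to the same side cancel. If $m$ cusps remain on the loop $C$ after all cancellations, its arrow number is $a(C)=m/2$, and $a(S)=\sum_{C}a(C)$. Let $\alpha$ and $\beta$ be the numbers of smoothings with coefficient $A$ and $A^{-1}$, $d=-A^2-A^{-2}$, and $K_0=1$. The arrow polynomial is $$\langle K\rangle_A=\sum_S A^{\alpha-\beta}d^{|S|-1}\prod_{C}K_{a(C)}\in\mathbb Z[A,A^{-1},K_1,K_2,\dots].$$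 The k-degree of a monomial $A^mK_{i_1}^{j_1}\cdots K_{i_r}^{j_r}$ is $i_1j_1+\dots+i_rj_r$. The maximum k-degree of $\langle K\rangle_A$ is the largest k-degree of a monomial that occurs in it with non-zero coefficient. A labeling $L$ of $S$ assigns $0$ or $1$ to each edge so that along each loop the label changes exactly at the cusps. It determines a diagram $\lambda(S)$, oriented like $K$. Orientation-respecting smoothings are kept. A c-pair is replaced by a crossing of the two strands that join each incoming end to the opposite outgoing end if these ends have equal labels, the strand labeled $0$ crossing over the strand labeled $1$; otherwise it is replaced by two disjoint parallel strands. A virtual crossing becomes a classical crossing, in which the strand labeled $1$ is the overcrossing strand if the labels differ, and the strand from left to right is the overcrossing strand if they agree. The sign $\operatorname{sgn}(c)\in\{0,1,-1\}$ of a c-pair $c$ is the sign of the crossing that replaces it, or $0$ if there is none. $Lk(i,j)$ is the sum of the signs of the crossings of $\lambda(S)$ at which a strand labeled $i$ crosses over a strand labeled $j$, and $Lk(\lambda(S))=|Lk(0,1)|$. **Theorem.** Let $K$ be a virtual link diagram. 1. For every state $S$ of $K$ and every labeling of $S$: $\lambda(S)$ is a classical (planar) link diagram and the labels are constant along its strands;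 $Lk(0,1)=Lk(1,0)$; $Lk(\lambda(S))$ is at most the number of virtual crossings of the diagram $K$; $\sum_{c}\operatorname{sgn}(c)=Lk(0,1)$, the sum being over all c-pairs of $S$; and $\sum_c\operatorname{sgn}(c)\le a(S)$. 2. Every state $S$ of $K$ has a labeling for which $\sum_c\operatorname{sgn}(c)=a(S)$ and hence $Lk(\lambda(S))=a(S)$. 3. The virtual crossing number $v(K)$ is greater than or equal to the maximum k-degree of $\langle K\rangle_A$. -/

import Mathlib

/-! Oriented virtual link diagrams, as plane graphs given by rotation systems. -/

/-- An oriented link diagram drawn on some closed oriented surface, up to homeomorphism.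

`X` is the set of crossings (4-valent vertices) and `M` a set of marked points (2-valent vertices)
on the curves; marked points carry no information, and they allow a component without crossings.
`sgn x` is `0` if `x` is a virtual crossing, and the sign `1` or `-1` of `x` if it is classical.

Turn every crossing so that both strands run upwards. It has two incoming ends `(x, true)`
(bottom left) and `(x, false)` (bottom right), and two outgoing ends `(x, true)` (top left) and
`(x, false)` (top right). The strand that comes in at `(x, s)` leaves at `(x, !s)`. In a positive
crossing the strand from bottom left to top right is the overcrossing strand, in a negative one
the strand from bottom right to top left. A marked point has one incoming and one outgoing end.
The edge that starts at the outgoing end `p` arrives at the incoming end `next p`. -/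
structure DiagramCode where
  X : Type
  M : Type
  [fintypeX : Fintype X]
  [decEqX : DecidableEq X]
  [fintypeM : Fintype M]
  [decEqM : DecidableEq M]
  sgn : X → SignType
  next : Equiv.Perm ((X × Bool) ⊕ M)

attribute [instance] DiagramCode.fintypeX DiagramCode.decEqX
  DiagramCode.fintypeM DiagramCode.decEqM

/-- The set of orbits of the group generated by a set of permutations. -/
abbrev OrbitSet {α : Type} (s : Set (Equiv.Perm α)) : Type :=
  MulAction.orbitRel.Quotient (Subgroup.closure s) α

namespace DiagramCode

/-- Names for the outgoing ends, and also for the incoming ends. An edge is named by the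
outgoing end at which it starts. -/
abbrev End (D : DiagramCode) : Type := (D.X × Bool) ⊕ D.M

/-- Half edges: `(p, true)` is the outgoing end `p`, and `(p, false)` is the incoming end `p`. -/
abbrev Dart (D : DiagramCode) : Type := D.End × Bool

/-- The involution that exchanges the two ends of every edge. -/
def edgeFlip (D : DiagramCode) : Equiv.Perm D.Dart where
  toFun
    | (p, true) => (D.next p, false)
    | (q, false) => (D.next.symm q, true)
  invFun
    | (p, true) => (D.next p, false)
    | (q, false) => (D.next.symm q, true)
  left_inv := by rintro ⟨p, _ | _⟩ <;> simp
  right_inv := by rintro ⟨p, _ | _⟩ <;> simp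

/-- The counterclockwise rotation of the ends around every vertex: at a crossing, bottom left,
bottom right, top right, top left. -/
def rotation (D : DiagramCode) : Equiv.Perm D.Dart where
  toFun
    | (Sum.inl (x, s), o) => (Sum.inl (x, o), !s)
    | (Sum.inr m, o) => (Sum.inr m, !o)
  invFun
    | (Sum.inl (x, s), o) => (Sum.inl (x, !o), s)
    | (Sum.inr m, o) => (Sum.inr m, !o)
  left_inv := by rintro ⟨⟨x, s⟩ | m, o⟩ <;> simp
  right_inv := by rintro ⟨⟨x, s⟩ | m, o⟩ <;> simp

/-- The faces of the rotation system. -/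
abbrev Face (D : DiagramCode) : Type := OrbitSet {D.rotation * D.edgeFlip}

/-- The connected components of the underlying graph. -/
abbrev GraphComponent (D : DiagramCode) : Type := OrbitSet {D.rotation, D.edgeFlip}

/-- All components of the graph have genus `0`, by Euler's formula `V - E + F = 2 C`. -/
def IsPlanar (D : DiagramCode) : Prop :=
  Fintype.card (D.X ⊕ D.M) + Nat.card D.Face = Fintype.card D.End + 2 * Nat.card D.GraphComponent

/-- The number of virtual crossings of a diagram. -/
def numVirtual (D : DiagramCode) : ℕ := Fintype.card {x : D.X // D.sgn x = 0}

/-- A classical link diagram: planar, without virtual crossings. -/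
def IsClassical (D : DiagramCode) : Prop := D.IsPlanar ∧ ∀ x, D.sgn x ≠ 0

/-! ### Moves -/

/-- Orientation-preserving isomorphism of diagrams. -/
structure Iso (D D' : DiagramCode) where
  onX : D.X ≃ D'.X
  onM : D.M ≃ D'.M
  sgn_eq : ∀ x, D'.sgn (onX x) = D.sgn x
  next_eq : ∀ p, D'.next ((onX.prodCongr (Equiv.refl Bool)).sumCongr onM p) =
    (onX.prodCongr (Equiv.refl Bool)).sumCongr onM (D.next p)

/-- The ends after insertion of one new marked point, called `none`. -/
def optionEnd (X M : Type) : (X × Bool) ⊕ Option M ≃ Option ((X × Bool) ⊕ M) where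
  toFun
    | Sum.inl p => some (Sum.inl p)
    | Sum.inr none => none
    | Sum.inr (some m) => some (Sum.inr m)
  invFun
    | some (Sum.inl p) => Sum.inl p
    | none => Sum.inr none
    | some (Sum.inr m) => Sum.inr (some m)
  left_inv := by rintro (p | _ | m) <;> rfl
  right_inv := by rintro (_ | p | m) <;> rfl

/-- Insert a marked point in the middle of the edge that starts at `e`. -/
def subdivide (D : DiagramCode) (e : D.End) : DiagramCode where
  X := D.X
  M := Option D.M
  sgn := D.sgn
  next := (optionEnd D.X D.M).trans
    (((Equiv.swap none (some e)).trans (Equiv.optionCongr D.next)).trans (optionEnd D.X D.M).symm)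

end DiagramCode

/-- A tangle of `n` oriented strands in a disk, with `m` crossings and no closed component. The
`j`-th entry point is where a strand enters the disk; `wiring` sends every start of an edge (an
outgoing end of a crossing or an entry point) to its target (an incoming end of a crossing or an
exit point). -/
structure Tangle (n : ℕ) where
  m : ℕ
  sgn : Fin m → SignType
  wiring : (Fin m × Bool) ⊕ Fin n ≃ (Fin m × Bool) ⊕ Fin n

/-- The part of a diagram outside a disk. `wiring` sends every start of an edge (an outgoing end or
an exit point of the disk) to its target (an incoming end or an entry point of the disk). -/
structure OuterTangle (n : ℕ) where
  X : Type
  M : Type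
  [fintypeX : Fintype X]
  [decEqX : DecidableEq X]
  [fintypeM : Fintype M]
  [decEqM : DecidableEq M]
  sgn : X → SignType
  wiring : ((X × Bool) ⊕ M) ⊕ Fin n ≃ ((X × Bool) ⊕ M) ⊕ Fin n

attribute [instance] OuterTangle.fintypeX OuterTangle.decEqX
  OuterTangle.fintypeM OuterTangle.decEqM

namespace OuterTangle

/-- The entry points and exit points of the disk become marked points of the glued diagram. An
incoming end lies outside or inside the disk; for this, entry points count as outside. -/
def inSplit (X M Y : Type) (n : ℕ) :
    ((X ⊕ Y) × Bool) ⊕ (M ⊕ (Fin n ⊕ Fin n)) ≃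
      (((X × Bool) ⊕ M) ⊕ Fin n) ⊕ ((Y × Bool) ⊕ Fin n) where
  toFun
    | Sum.inl (Sum.inl x, s) => Sum.inl (Sum.inl (Sum.inl (x, s)))
    | Sum.inl (Sum.inr y, s) => Sum.inr (Sum.inl (y, s))
    | Sum.inr (Sum.inl m) => Sum.inl (Sum.inl (Sum.inr m))
    | Sum.inr (Sum.inr (Sum.inl j)) => Sum.inl (Sum.inr j)
    | Sum.inr (Sum.inr (Sum.inr j)) => Sum.inr (Sum.inr j)
  invFun
    | Sum.inl (Sum.inl (Sum.inl (x, s))) => Sum.inl (Sum.inl x, s)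
    | Sum.inr (Sum.inl (y, s)) => Sum.inl (Sum.inr y, s)
    | Sum.inl (Sum.inl (Sum.inr m)) => Sum.inr (Sum.inl m)
    | Sum.inl (Sum.inr j) => Sum.inr (Sum.inr (Sum.inl j))
    | Sum.inr (Sum.inr j) => Sum.inr (Sum.inr (Sum.inr j))
  left_inv := by rintro (⟨x | y, s⟩ | m | j | j) <;> rfl
  right_inv := by rintro (((⟨x, s⟩ | m) | j) | (⟨y, s⟩ | j)) <;> rfl

/-- An outgoing end lies outside or inside the disk; for this, exit points count as outside. -/
def outSplit (X M Y : Type) (n : ℕ) :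
    ((X ⊕ Y) × Bool) ⊕ (M ⊕ (Fin n ⊕ Fin n)) ≃
      (((X × Bool) ⊕ M) ⊕ Fin n) ⊕ ((Y × Bool) ⊕ Fin n) where
  toFun
    | Sum.inl (Sum.inl x, s) => Sum.inl (Sum.inl (Sum.inl (x, s)))
    | Sum.inl (Sum.inr y, s) => Sum.inr (Sum.inl (y, s))
    | Sum.inr (Sum.inl m) => Sum.inl (Sum.inl (Sum.inr m))
    | Sum.inr (Sum.inr (Sum.inl j)) => Sum.inr (Sum.inr j)
    | Sum.inr (Sum.inr (Sum.inr j)) => Sum.inl (Sum.inr j)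
  invFun
    | Sum.inl (Sum.inl (Sum.inl (x, s))) => Sum.inl (Sum.inl x, s)
    | Sum.inr (Sum.inl (y, s)) => Sum.inl (Sum.inr y, s)
    | Sum.inl (Sum.inl (Sum.inr m)) => Sum.inr (Sum.inl m)
    | Sum.inl (Sum.inr j) => Sum.inr (Sum.inr (Sum.inr j))
    | Sum.inr (Sum.inr j) => Sum.inr (Sum.inr (Sum.inl j))
  left_inv := by rintro (⟨x | y, s⟩ | m | j | j) <;> rfl
  right_inv := by rintro (((⟨x, s⟩ | m) | j) | (⟨y, s⟩ | j)) <;> rfl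

/-- Glue a tangle into the disk. -/
def fill {n : ℕ} (C : OuterTangle n) (T : Tangle n) : DiagramCode where
  X := C.X ⊕ Fin T.m
  M := C.M ⊕ (Fin n ⊕ Fin n)
  sgn := Sum.elim C.sgn T.sgn
  next := (outSplit C.X C.M (Fin T.m) n).trans
    ((C.wiring.sumCongr T.wiring).trans (inSplit C.X C.M (Fin T.m) n).symm)

end OuterTangle

namespace Tangle

/-- `n` strands without crossings. -/
def trivial (n : ℕ) : Tangle n where
  m := 0
  sgn := fun _ => 0
  wiring := Equiv.refl _

/-- A strand with a kink. The strand enters the crossing on side `s`. -/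
def kink (ε : SignType) (s : Bool) : Tangle 1 where
  m := 1
  sgn := fun _ => ε
  wiring :=
    { toFun := fun p => match p with
        | Sum.inr j => Sum.inl (j, s)
        | Sum.inl (c, t) => if t = s then Sum.inr c else Sum.inl (c, !s)
      invFun := fun p => match p with
        | Sum.inl (c, t) => if t = s then Sum.inr c else Sum.inl (c, !s)
        | Sum.inr j => Sum.inl (j, s)
      left_inv := by revert s; decide
      right_inv := by revert s; decide }

/-- Two parallel strands that run in the same direction, cross at crossing `0`, and cross back at
crossing `1`. Strand `0` starts and ends on the left. -/
def bigonParallel (ε : SignType) : Tangle 2 where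
  m := 2
  sgn := fun c => if c = 0 then ε else -ε
  wiring :=
    { toFun := fun p => match p with
        | Sum.inr j => Sum.inl (0, decide (j = 0))
        | Sum.inl (c, t) => if c = 0 then Sum.inl (1, t) else Sum.inr (if t then 0 else 1)
      invFun := fun p => match p with
        | Sum.inl (c, t) => if c = 0 then Sum.inr (if t then 0 else 1) else Sum.inl (0, t)
        | Sum.inr j => Sum.inl (1, decide (j = 0))
      left_inv := by decide
      right_inv := by decide }

/-- Two strands that run in opposite directions and form a bigon with corners at the crossings `0`
and `1`. Strand `0` passes crossing `0` first, and strand `1` passes crossing `1` first. The bigon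
lies to the left of both strands if `s = true`, and to the right of both if `s = false`. -/
def bigonAntiparallel (ε : SignType) (s : Bool) : Tangle 2 where
  m := 2
  sgn := fun c => if c = 0 then ε else -ε
  wiring :=
    { toFun := fun p => match p with
        | Sum.inr j => Sum.inl (j, !s)
        | Sum.inl (c, t) => if t = s then Sum.inl (c + 1, s) else Sum.inr (c + 1)
      invFun := fun p => match p with
        | Sum.inl (c, t) => if t = s then Sum.inl (c + 1, s) else Sum.inr c
        | Sum.inr j => Sum.inl (j + 1, !s)
      left_inv := by revert s; decide
      right_inv := by revert s; decide }

/-- In a triangle of three strands `0, 1, 2`, crossing `k` is the crossing of the strands `k + 1`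
and `k + 2` (modulo 3). `δ k = true` means that strand `k + 1` passes it from bottom left to top
right (and strand `k + 2` from bottom right to top left). This is the side on which strand `i`
enters crossing `k`. -/
def triSide (δ : Fin 3 → Bool) (i k : Fin 3) : Bool := if i = k + 1 then δ k else !δ k

/-- The strand that enters crossing `k` on side `t`. -/
def triStrand (δ : Fin 3 → Bool) (k : Fin 3) (t : Bool) : Fin 3 :=
  if δ k = t then k + 1 else k + 2

/-- The first crossing on strand `i`. For given directions `δ` of three lines in the plane there are
two possible positions of the lines, up to isotopy, told apart by `η`. -/
def triFirst (δ : Fin 3 → Bool) (η : Bool) (i : Fin 3) : Fin 3 := if η = δ i then i + 1 else i + 2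

/-- The second crossing on strand `i`. -/
def triSecond (δ : Fin 3 → Bool) (η : Bool) (i : Fin 3) : Fin 3 := triFirst δ (!η) i

/-- Three strands that cross pairwise, like three lines in general position. -/
def triangle (δ : Fin 3 → Bool) (ε : Fin 3 → SignType) (η : Bool) : Tangle 3 where
  m := 3
  sgn := ε
  wiring :=
    { toFun := fun p => match p with
        | Sum.inr i => Sum.inl (triFirst δ η i, triSide δ i (triFirst δ η i))
        | Sum.inl (k, t) =>
            let i := triStrand δ k (!t)
            if k = triFirst δ η i then Sum.inl (triSecond δ η i, triSide δ i (triSecond δ η i))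
            else Sum.inr i
      invFun := fun p => match p with
        | Sum.inr i => Sum.inl (triSecond δ η i, !triSide δ i (triSecond δ η i))
        | Sum.inl (k, t) =>
            let i := triStrand δ k t
            if k = triFirst δ η i then Sum.inr i
            else Sum.inl (triFirst δ η i, !triSide δ i (triFirst δ η i))
      left_inv := by
        clear ε
        revert δ η
        decide
      right_inv := by
        clear ε
        revert δ η
        decide }

/-- `+1` if strand `k + 1` crosses over strand `k + 2` at crossing `k`, `-1` if it crosses under,
and `0` if the crossing is virtual. -/
def triHeight (δ : Fin 3 → Bool) (ε : Fin 3 → SignType) (k : Fin 3) : SignType :=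
  if δ k then ε k else -ε k

/-- Three strands one of which is on top and one of which is at the bottom. -/
def TriClassical (δ : Fin 3 → Bool) (ε : Fin 3 → SignType) : Prop :=
  (∀ k, ε k ≠ 0) ∧ ∃ k l, triHeight δ ε k ≠ triHeight δ ε l

/-- One strand has only virtual crossings with the other two. -/
def TriVirtual (ε : Fin 3 → SignType) : Prop := ∃ k, ∀ l, l ≠ k → ε l = 0

end Tangle

/-- The elementary moves. A marked point may be inserted. With `ε = 0` the moves `one`,
`two_parallel` and `two_antiparallel` are the first two virtual Reidemeister moves, with `ε ≠ 0`
the first two classical ones. `three_virtual` is the third virtual move (three virtual crossings)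
and the mixed move (a strand with two virtual crossings passes over a classical crossing). -/
inductive DiagramCode.Step : DiagramCode → DiagramCode → Prop
  | iso {D D' : DiagramCode} (e : DiagramCode.Iso D D') : DiagramCode.Step D D'
  | subdivide (D : DiagramCode) (e : D.End) : DiagramCode.Step D (D.subdivide e)
  | one (C : OuterTangle 1) (ε : SignType) (s : Bool) :
      DiagramCode.Step (C.fill (Tangle.trivial 1)) (C.fill (Tangle.kink ε s))
  | two_parallel (C : OuterTangle 2) (ε : SignType) :
      DiagramCode.Step (C.fill (Tangle.trivial 2)) (C.fill (Tangle.bigonParallel ε))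
  | two_antiparallel (C : OuterTangle 2) (ε : SignType) (s : Bool) :
      DiagramCode.Step (C.fill (Tangle.trivial 2)) (C.fill (Tangle.bigonAntiparallel ε s))
  | three_classical (C : OuterTangle 3) (δ : Fin 3 → Bool) (ε : Fin 3 → SignType)
      (h : Tangle.TriClassical δ ε) :
      DiagramCode.Step (C.fill (Tangle.triangle δ ε true)) (C.fill (Tangle.triangle δ ε false))
  | three_virtual (C : OuterTangle 3) (δ : Fin 3 → Bool) (ε : Fin 3 → SignType)
      (h : Tangle.TriVirtual ε) :
      DiagramCode.Step (C.fill (Tangle.triangle δ ε true)) (C.fill (Tangle.triangle δ ε false))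

/-- An oriented virtual link diagram: a nonempty planar diagram with classical and virtual
crossings. The mutual position of the components of the underlying graph in the plane is not
recorded: it does not change the virtual link, the crossings or the states. -/
structure VirtualLinkDiagram extends DiagramCode where
  planar : toDiagramCode.IsPlanar
  nonempty : Nonempty toDiagramCode.End

namespace VirtualLinkDiagram

/-- Virtual equivalence: a sequence of moves, and their inverses, through planar diagrams. -/
def Equivalent : VirtualLinkDiagram → VirtualLinkDiagram → Prop :=
  Relation.EqvGen fun K K' => DiagramCode.Step K.toDiagramCode K'.toDiagramCode

/-- The virtual crossing number: the least number of virtual crossings in a diagram of the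
virtual link represented by `K`. -/
noncomputable def virtualCrossingNumber (K : VirtualLinkDiagram) : ℕ :=
  sInf {n | ∃ K' : VirtualLinkDiagram, Equivalent K K' ∧ K'.numVirtual = n}

end VirtualLinkDiagram

/-! ### States and the arrow polynomial -/

/-- Two adjacent cusps of a loop that point to the same side are cancelled. A loop is given by the
cyclic word of the sides of its cusps. -/
inductive CuspCancel : Cycle Bool → Cycle Bool → Prop
  | cancel (b : Bool) (l : List Bool) : CuspCancel (↑(b :: b :: l)) (↑l)

namespace DiagramCode

/-- A state: every classical crossing is smoothed, with coefficient `A` (`true`) or `A⁻¹`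
(`false`). -/
abbrev State (D : DiagramCode) : Type := {x : D.X // D.sgn x ≠ 0} → Bool

namespace State

variable {D : DiagramCode}

/-- The `A`-smoothing of a positive crossing and the `A⁻¹`-smoothing of a negative one respect the
orientation. The other smoothing joins the two incoming ends and joins the two outgoing ends, and it
produces the two cusps of a c-pair. -/
def IsCPair (S : D.State) (x : D.X) : Prop :=
  ∃ h : D.sgn x ≠ 0, S ⟨x, h⟩ ≠ decide (D.sgn x = 1)

instance (S : D.State) (x : D.X) : Decidable (S.IsCPair x) := by
  unfold IsCPair; infer_instance

/-- How the state joins the ends at every vertex. -/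
def passFun (S : D.State) : D.Dart → D.Dart
  | (Sum.inr m, o) => (Sum.inr m, !o)
  | (Sum.inl (x, s), o) =>
      if D.sgn x = 0 then (Sum.inl (x, !s), !o)
      else if S.IsCPair x then (Sum.inl (x, !s), o)
      else (Sum.inl (x, s), !o)

theorem passFun_involutive (S : D.State) : Function.Involutive S.passFun := by
  rintro ⟨⟨x, s⟩ | m, o⟩
  · by_cases h : D.sgn x = 0
    · simp [passFun, h]
    · by_cases h' : S.IsCPair x <;> simp [passFun, h, h']
  · simp [passFun]

def pass (S : D.State) : Equiv.Perm D.Dart := S.passFun_involutive.toPerm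

/-- The loops of a state. -/
abbrev Loop (S : D.State) : Type := OrbitSet {D.edgeFlip, S.pass}

/-- One step along a loop: from the dart at which one arrives at a vertex, through the vertex and
along the next edge. -/
def travel (S : D.State) : Equiv.Perm D.Dart := D.edgeFlip * S.pass

/-- The cusp that one passes when one arrives at a vertex along the dart `h`, if there is one;
`some true` if it points to the left of the direction of travel, `some false` if it points to
the right. (Cusps of a crossing point to the centre of the crossing.) -/
def cusp (S : D.State) : D.Dart → Option Bool
  | (Sum.inr _, _) => none
  | (Sum.inl (x, s), o) => if S.IsCPair x then some (xor s o) else none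

/-- The sides of the cusps in one tour along a loop, from the dart `h`. -/
noncomputable def word (S : D.State) (h : D.Dart) : List Bool :=
  (List.range (Function.minimalPeriod S.travel h)).filterMap fun i => S.cusp (S.travel^[i] h)

/-- The number of cusps that remain on a loop after reduction. The tour may begin at any dart of the
loop, in both directions. -/
noncomputable def reducedCusps (S : D.State) (C : S.Loop) : ℕ :=
  sInf {n | ∃ (h : D.Dart) (w : Cycle Bool), (Quotient.mk _ h : S.Loop) = C ∧
    Relation.ReflTransGen CuspCancel (S.word h : Cycle Bool) w ∧ w.length = n}

/-- The arrow number of a loop. (The number of cusps is even.) -/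
noncomputable def loopArrowNumber (S : D.State) (C : S.Loop) : ℕ := S.reducedCusps C / 2

/-- The arrow number of a state. -/
noncomputable def arrowNumber (S : D.State) : ℕ := ∑ᶠ C : S.Loop, S.loopArrowNumber C

/-- `α - β`. -/
def exponent (S : D.State) : ℤ := ∑ x, if S x then 1 else -1

end State
end DiagramCode

/-- `ℤ[A, A⁻¹, K₁, K₂, …]`. -/
abbrev ArrowRing : Type := MvPolynomial ℕ+ (LaurentPolynomial ℤ)

/-- `d = -A² - A⁻²`. -/
noncomputable def loopValue : LaurentPolynomial ℤ :=
  -LaurentPolynomial.T 2 - LaurentPolynomial.T (-2)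

/-- The variable `K_n`, and `1` for `n = 0`. -/
noncomputable def arrowVar (n : ℕ) : ArrowRing :=
  if h : 0 < n then MvPolynomial.X ⟨n, h⟩ else 1

/-- The arrow polynomial `⟨D⟩_A`. -/
noncomputable def DiagramCode.arrowPolynomial (D : DiagramCode) : ArrowRing :=
  ∑ S : D.State,
    MvPolynomial.C (LaurentPolynomial.T S.exponent * loopValue ^ (Nat.card S.Loop - 1)) *
      ∏ᶠ C : S.Loop, arrowVar (S.loopArrowNumber C)

/-- The k-degree `i₁ j₁ + ⋯ + i_v j_v` of a monomial `K_{i₁}^{j₁} ⋯ K_{i_v}^{j_v}`. -/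
def kDegree (m : ℕ+ →₀ ℕ) : ℕ := m.sum fun i j => (i : ℕ) * j

/-- The greatest k-degree of the summands of a polynomial. -/
noncomputable def maxKDegree (p : ArrowRing) : ℕ := p.support.sup kDegree

/-! ### Labelings and linking numbers -/

namespace DiagramCode

/-- The label of the edge that arrives at the incoming end `q`, for a `0`-`1`-labeling `L` of the
edges (`false` is `0`, `true` is `1`). -/
def inLabel (D : DiagramCode) (L : D.End → Bool) (q : D.End) : Bool := L (D.next.symm q)

/-- The label of the edge to which a dart belongs. -/
def dartLabel (D : DiagramCode) (L : D.End → Bool) : D.Dart → Bool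
  | (p, true) => L p
  | (q, false) => D.inLabel L q

/-- The label of the overcrossing strand of a classical crossing. -/
def overLabel (D : DiagramCode) (L : D.End → Bool) (x : D.X) : Bool :=
  D.inLabel L (Sum.inl (x, decide (D.sgn x = 1)))

/-- The label of the undercrossing strand of a classical crossing. -/
def underLabel (D : DiagramCode) (L : D.End → Bool) (x : D.X) : Bool :=
  D.inLabel L (Sum.inl (x, !decide (D.sgn x = 1)))

/-- `Lk(i, j)`: the sum of the signs of the classical crossings at which a strand with label `i`
crosses over a strand with label `j`. -/
def linking (D : DiagramCode) (L : D.End → Bool) (i j : Bool) : ℤ :=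
  ∑ x : D.X, if D.overLabel L x = i ∧ D.underLabel L x = j then (D.sgn x : ℤ) else 0

namespace State

variable {D : DiagramCode}

/-- An alternating labeling of a state: the label changes at every cusp, and nowhere else. -/
def IsLabeling (S : D.State) (L : D.End → Bool) : Prop :=
  ∀ h : D.Dart, D.dartLabel L (S.pass h) ≠ D.dartLabel L h ↔ (S.cusp h).isSome

/-- The crossings that remain in `λ(S)`: the virtual crossings, and the c-pairs in which each
incoming end has the label of the outgoing end opposite to it. The other c-pairs are replaced by two
parallel strands without a crossing. -/
def Keeps (S : D.State) (L : D.End → Bool) (x : D.X) : Prop :=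
  D.sgn x = 0 ∨
    (S.IsCPair x ∧ D.inLabel L (Sum.inl (x, true)) = L (Sum.inl (x, false)))

instance (S : D.State) (L : D.End → Bool) : DecidablePred (S.Keeps L) := fun x => by
  unfold Keeps; infer_instance

/-- The sign of a crossing of `λ(S)`. At a virtual crossing of the state between strands with
different labels the strand `1` becomes the overcrossing strand; between strands with equal labels
the strand from left to right. At a c-pair the strand `0` becomes the overcrossing strand. -/
def lambdaSgn (S : D.State) (L : D.End → Bool) (x : {x : D.X // S.Keeps L x}) : SignType :=
  if D.sgn x.1 = 0 then
    if D.inLabel L (Sum.inl (x.1, true)) = false ∧ D.inLabel L (Sum.inl (x.1, false)) = true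
    then -1 else 1
  else
    if D.inLabel L (Sum.inl (x.1, true)) = false then 1 else -1

/-- The ends of `D` are the ends of `λ(S)`: a crossing that does not remain becomes two marked
points, one on each of the two parallel strands. -/
def lambdaEnd (S : D.State) (L : D.End → Bool) :
    D.End ≃ ({x : D.X // S.Keeps L x} × Bool) ⊕ (D.M ⊕ ({x : D.X // ¬S.Keeps L x} × Bool)) where
  toFun
    | Sum.inl (x, s) =>
        if h : S.Keeps L x then Sum.inl (⟨x, h⟩, s) else Sum.inr (Sum.inr (⟨x, h⟩, s))
    | Sum.inr m => Sum.inr (Sum.inl m)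
  invFun
    | Sum.inl (x, s) => Sum.inl (x.1, s)
    | Sum.inr (Sum.inr (x, s)) => Sum.inl (x.1, s)
    | Sum.inr (Sum.inl m) => Sum.inr m
  left_inv := by
    rintro (⟨x, s⟩ | m)
    · by_cases h : S.Keeps L x <;> simp [h]
    · rfl
  right_inv := by
    rintro (⟨⟨x, h⟩, s⟩ | m | ⟨⟨x, h⟩, s⟩)
    · simp [h]
    · rfl
    · simp [h]

/-- The diagram `λ(S)` of a labeled state, oriented like `D`. -/
def lambda (S : D.State) (L : D.End → Bool) : DiagramCode where
  X := {x : D.X // S.Keeps L x}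
  M := D.M ⊕ ({x : D.X // ¬S.Keeps L x} × Bool)
  sgn := S.lambdaSgn L
  next := (S.lambdaEnd L).permCongr D.next

/-- The labels of the edges of `λ(S)`. -/
def lambdaLabel (S : D.State) (L : D.End → Bool) : (S.lambda L).End → Bool :=
  L ∘ (S.lambdaEnd L).symm

/-- The linking number `Lk(i, j)` of `λ(S)`. -/
def lambdaLinking (S : D.State) (L : D.End → Bool) (i j : Bool) : ℤ :=
  (S.lambda L).linking (S.lambdaLabel L) i j

/-- The sign of a c-pair: the sign of the crossing of `λ(S)` that replaces it, and `0` if there is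
no such crossing. -/
def cPairSign (S : D.State) (L : D.End → Bool) (x : D.X) : ℤ :=
  if h : S.Keeps L x then ((S.lambda L).sgn ⟨x, h⟩ : ℤ) else 0

/-- The sum of the signs of the c-pairs of a labeled state. -/
def cPairSum (S : D.State) (L : D.End → Bool) : ℤ :=
  ∑ x : D.X, if S.IsCPair x then S.cPairSign L x else 0

end State
end DiagramCode

/-!
The bound for the virtual crossing number has two independent halves: the k-degree of every monomial
of `⟨K⟩_A` is the arrow number of a state and at most the number of virtual crossings of `K`, and
the maximum k-degree does not change under the moves.

*Labeled states.* The edges labeled `0` form a cycle of the graph of `K`, since at every vertex as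
many incoming as outgoing ends are labeled `0`, also at a c-pair. On a planar diagram every
cycle is the boundary of a function `f` on the faces (`isPlanar_iff`: Euler's formula says that the
first homology vanishes, by a count of dimensions). If one adds up the change of `f` along the
edges labeled `1`, every crossing of `λ(S)` between strands with different labels contributes its
sign if the strand `0` is on top, and minus its sign otherwise, and the sum telescopes to zero
(`sum_crossingNumberAt`). At c-pairs the strand `0` is on top and at virtual crossings the
strand `1` is on top, so this is `Lk(0, 1) = Lk(1, 0)`; the first number is the sum of the signs of
the c-pairs, the second has a summand `0`, `1` or `-1` for every virtual crossing.

*Arrow numbers.* Give the two ends of a cusp the weights `1` and `-1` according to the side of the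
crossing, regardless of the direction of travel. In a tour along a loop the orientation of the
diagram is followed and opposed in turn, and it changes at every cusp. Hence the sum of the weights
is the alternating sum of the sides of the cusps, whose absolute value is the number of cusps that
remain after all cancellations (`reducedCusps_mk`). A labeling is the same as a choice of a
direction for every loop, and the sum of the signs of the c-pairs is half of the sum of the weights
of the tours in these directions. It is largest if all weights are nonnegative
(`exists_labeling_cPairSum_eq`).

*Moves.* By the preceding paragraph a state enters the arrow polynomial only through the multiset of
the absolute values of the weights of its tours. This multiset can be computed in a part of the
diagram that every tour meets: the weights of a permutation agree with those of its first return
map, since they differ by a coboundary (`weights_firstReturn`). For a diagram glued from a tangle in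
a disk and the part outside, the first return map to the outside depends on the tangle only through
the arcs that join its boundary points and their weights, and closed loops in the disk contribute
factors `d` (`weights_fill`). So the arrow polynomial is a linear function of the state sum of the
tangle, a formal combination of such systems of arcs over `ℤ[A, A⁻¹]`. For the two sides of each
move these state sums agree up to a unit `c A ^ e`, which is a finite computation
(`Tangle.skein_kink` to `Tangle.triSkein_of_triClassical`). Multiplication by a unit does not
change the k-degrees.
-/

/-! ### Planarity as the vanishing of the first homology -/

/-- The rational functions on `α` that are invariant under a set of permutations. -/
def invariantFunctions {α : Type} (s : Set (Equiv.Perm α)) : Submodule ℚ (α → ℚ) where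
  carrier := {f | ∀ g ∈ s, ∀ a, f (g a) = f a}
  add_mem' {f f'} hf hf' g hg a := by simp [hf g hg a, hf' g hg a]
  zero_mem' g _ a := rfl
  smul_mem' c f hf g hg a := by simp [hf g hg a]

theorem mem_invariantFunctions {α : Type} {s : Set (Equiv.Perm α)} {f : α → ℚ} :
    f ∈ invariantFunctions s ↔ ∀ g ∈ s, ∀ a, f (g a) = f a := Iff.rfl

/-- A function that is invariant under the generators is invariant under the group. -/
theorem apply_closure_eq {α β : Type} {s : Set (Equiv.Perm α)} {f : α → β}
    (hf : ∀ g ∈ s, ∀ a, f (g a) = f a) {g : Equiv.Perm α} (hg : g ∈ Subgroup.closure s) :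
    ∀ a, f (g a) = f a := by
  induction hg using Subgroup.closure_induction with
  | mem x hx => exact hf x hx
  | one => intro a; rfl
  | mul x y _ _ hx hy => intro a; rw [Equiv.Perm.mul_apply, hx, hy]
  | inv x _ hx => intro a; rw [← hx (x⁻¹ a)]; simp

theorem orbitSet_mk_apply {α : Type} {s : Set (Equiv.Perm α)} {g : Equiv.Perm α} (hg : g ∈ s)
    (a : α) : (Quotient.mk _ (g a) : OrbitSet s) = Quotient.mk _ a :=
  Quotient.sound ⟨⟨g, Subgroup.subset_closure hg⟩, rfl⟩

theorem finrank_invariantFunctions {α : Type} [Finite α] (s : Set (Equiv.Perm α)) :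
    Module.finrank ℚ (invariantFunctions s) = Nat.card (OrbitSet s) := by
  have := Fintype.ofFinite (OrbitSet s)
  let q : α → OrbitSet s := Quotient.mk _
  have hinj : Function.Injective (LinearMap.funLeft ℚ ℚ q) :=
    LinearMap.funLeft_injective_of_surjective _ _ _ Quotient.mk_surjective
  have hr : LinearMap.range (LinearMap.funLeft ℚ ℚ q) = invariantFunctions s := by
    ext f
    constructor
    · rintro ⟨u, rfl⟩ g hg a
      simp only [LinearMap.funLeft_apply, q, orbitSet_mk_apply hg]
    · intro hf
      refine ⟨Quotient.lift f ?_, rfl⟩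
      rintro a b ⟨⟨g, hg⟩, rfl⟩
      exact apply_closure_eq hf hg b
  rw [← hr, LinearMap.finrank_range_of_inj hinj, Module.finrank_fintype_fun_eq_card,
    Nat.card_eq_fintype_card]

namespace DiagramCode

variable (D : DiagramCode)

/-- The vertex at which an end lies. -/
def vertexOf : D.End → D.X ⊕ D.M := Sum.map Prod.fst id

theorem vertexOf_surjective : Function.Surjective D.vertexOf := by
  rintro (x | m)
  · exact ⟨Sum.inl (x, true), rfl⟩
  · exact ⟨Sum.inr m, rfl⟩

@[simp] theorem edgeFlip_true (p : D.End) : D.edgeFlip (p, true) = (D.next p, false) := rfl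

@[simp] theorem edgeFlip_false (q : D.End) : D.edgeFlip (q, false) = (D.next.symm q, true) := rfl

theorem edgeFlip_edgeFlip (h : D.Dart) : D.edgeFlip (D.edgeFlip h) = h := by
  rcases h with ⟨p, _ | _⟩ <;> simp

@[simp] theorem rotation_inl (x : D.X) (s o : Bool) :
    D.rotation (Sum.inl (x, s), o) = (Sum.inl (x, o), !s) := rfl

@[simp] theorem rotation_inr (m : D.M) (o : Bool) :
    D.rotation (Sum.inr m, o) = (Sum.inr m, !o) := rfl

/-- A rational flow on the edges: at every vertex the inflow is the outflow. -/
def IsCycle (z : D.End → ℚ) : Prop :=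
  (∀ x, z (D.next.symm (Sum.inl (x, true))) + z (D.next.symm (Sum.inl (x, false))) =
    z (Sum.inl (x, true)) + z (Sum.inl (x, false))) ∧
  ∀ m, z (D.next.symm (Sum.inr m)) = z (Sum.inr m)

/-- The matrix of the boundary map from edges to vertices. -/
def boundaryMatrix : Matrix (D.X ⊕ D.M) D.End ℚ :=
  Matrix.of fun v p => (if D.vertexOf (D.next p) = v then 1 else 0) -
    (if D.vertexOf p = v then 1 else 0)

theorem sum_at_vertex (u : D.End → ℚ) (v : D.X ⊕ D.M) :
    (∑ p, if D.vertexOf p = v then u p else 0) =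
      Sum.elim (fun x => u (Sum.inl (x, true)) + u (Sum.inl (x, false)))
        (fun m => u (Sum.inr m)) v := by
  rcases v with x | m
  · simp [vertexOf, Fintype.sum_prod_type, Finset.sum_add_distrib]
  · simp [vertexOf]

theorem mem_ker_boundaryMatrix (z : D.End → ℚ) :
    z ∈ LinearMap.ker D.boundaryMatrix.mulVecLin ↔ D.IsCycle z := by
  have key : ∀ v, D.boundaryMatrix.mulVec z v =
      (∑ p, if D.vertexOf p = v then z (D.next.symm p) else 0) -
        ∑ p, if D.vertexOf p = v then z p else 0 := by
    intro v
    rw [← Equiv.sum_comp D.next]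
    simp [Matrix.mulVec, dotProduct, boundaryMatrix, sub_mul, Finset.sum_sub_distrib]
  rw [LinearMap.mem_ker, Matrix.mulVecLin_apply, funext_iff]
  simp only [key, sum_at_vertex, Pi.zero_apply, sub_eq_zero, Sum.forall, Sum.elim_inl,
    Sum.elim_inr, IsCycle]

theorem boundaryMatrix_transpose_mulVec (g : D.X ⊕ D.M → ℚ) (p : D.End) :
    D.boundaryMatrix.transpose.mulVec g p = g (D.vertexOf (D.next p)) - g (D.vertexOf p) := by
  simp [Matrix.mulVec, dotProduct, boundaryMatrix, sub_mul, Finset.sum_sub_distrib]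

/-- The kernel of the coboundary map consists of the functions that are constant on the components
of the graph. -/
theorem finrank_ker_coboundary :
    Module.finrank ℚ (LinearMap.ker D.boundaryMatrix.transpose.mulVecLin) =
      Nat.card D.GraphComponent := by
  let v : D.Dart → D.X ⊕ D.M := fun h => D.vertexOf h.1
  have hv : Function.Surjective v := fun w => by
    obtain ⟨p, hp⟩ := D.vertexOf_surjective w
    exact ⟨(p, true), hp⟩
  have hinj : Function.Injective (LinearMap.funLeft ℚ ℚ v) :=
    LinearMap.funLeft_injective_of_surjective _ _ _ hv
  have hvr : ∀ h, v (D.rotation h) = v h := by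
    rintro ⟨⟨x, s⟩ | m, o⟩ <;> rfl
  have hmap : (LinearMap.ker D.boundaryMatrix.transpose.mulVecLin).map (LinearMap.funLeft ℚ ℚ v) =
      invariantFunctions {D.rotation, D.edgeFlip} := by
    ext f
    constructor
    · rintro ⟨g, hg, rfl⟩
      have hg' : ∀ p, g (D.vertexOf (D.next p)) = g (D.vertexOf p) := by
        intro p
        have := congrFun hg p
        rw [Matrix.mulVecLin_apply, boundaryMatrix_transpose_mulVec] at this
        exact sub_eq_zero.mp this
      rintro r (rfl | rfl) h
      · simp only [LinearMap.funLeft_apply, hvr]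
      · rcases h with ⟨p, _ | _⟩
        · have := hg' (D.next.symm p)
          rw [Equiv.apply_symm_apply] at this
          exact this.symm
        · exact hg' p
    · intro hf
      have hrot : ∀ h, f (D.rotation h) = f h := hf _ (by simp)
      have hflip : ∀ h, f (D.edgeFlip h) = f h := hf _ (by simp)
      have hfv : ∀ p o, f (p, o) = f (Function.surjInv hv (D.vertexOf p)) := by
        have h1 : ∀ p q o o', D.vertexOf p = D.vertexOf q → f (p, o) = f (q, o') := by
          rintro (⟨x, s⟩ | m) (⟨y, s'⟩ | m') o o' h
          · obtain rfl : x = y := by simpa [vertexOf] using h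
            have r : ∀ a b, f (Sum.inl (x, a), b) = f (Sum.inl (x, b), !a) := fun a b =>
              (hrot (Sum.inl (x, a), b)).symm
            have r1 := r true true
            have r2 := r true false
            have r3 := r false false
            cases s <;> cases s' <;> cases o <;> cases o' <;> simp only [Bool.not_true,
              Bool.not_false] at * <;> linarith
          · simp [vertexOf] at h
          · simp [vertexOf] at h
          · obtain rfl : m = m' := by simpa [vertexOf] using h
            have r1 := hrot (Sum.inr m, true)
            simp only [rotation_inr, Bool.not_true] at r1
            cases o <;> cases o' <;> linarith
        intro p o
        exact h1 _ _ _ _ (Function.surjInv_eq hv (D.vertexOf p)).symm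
      refine ⟨fun w => f (Function.surjInv hv w), ?_, ?_⟩
      · rw [SetLike.mem_coe, LinearMap.mem_ker]
        ext p
        rw [Matrix.mulVecLin_apply, boundaryMatrix_transpose_mulVec, ← hfv _ false, ← hfv _ true,
          ← edgeFlip_true, hflip, sub_self]
        rfl
      · ext ⟨p, o⟩
        exact (hfv p o).symm
  rw [← finrank_invariantFunctions, ← hmap]
  exact (Submodule.equivMapOfInjective _ hinj _).finrank_eq

theorem finrank_cycles :
    Module.finrank ℚ (LinearMap.ker D.boundaryMatrix.mulVecLin) + Fintype.card (D.X ⊕ D.M) =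
      Fintype.card D.End + Nat.card D.GraphComponent := by
  have h1 := LinearMap.finrank_range_add_finrank_ker D.boundaryMatrix.mulVecLin
  have h2 := LinearMap.finrank_range_add_finrank_ker D.boundaryMatrix.transpose.mulVecLin
  have h3 : Module.finrank ℚ (LinearMap.range D.boundaryMatrix.transpose.mulVecLin) =
      Module.finrank ℚ (LinearMap.range D.boundaryMatrix.mulVecLin) :=
    D.boundaryMatrix.rank_transpose
  rw [finrank_ker_coboundary, Module.finrank_fintype_fun_eq_card] at h2
  rw [Module.finrank_fintype_fun_eq_card] at h1
  omega

/-- The boundary of a function `f` on darts. For a function on faces, `f h` is the value on the face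
to the right of `h`, and the boundary at an edge is the value on its left minus the value on its
right. -/
def faceBoundary : (D.Dart → ℚ) →ₗ[ℚ] (D.End → ℚ) where
  toFun f p := f (D.edgeFlip (p, true)) - f (p, true)
  map_add' f g := by ext p; simp; ring
  map_smul' c f := by ext p; simp; ring

/-- Functions on the faces, seen as functions on the darts. -/
abbrev faceFunctions : Submodule ℚ (D.Dart → ℚ) := invariantFunctions {D.rotation * D.edgeFlip}

theorem mem_faceFunctions {f : D.Dart → ℚ} :
    f ∈ D.faceFunctions ↔ ∀ h, f (D.rotation h) = f (D.edgeFlip h) := by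
  simp only [mem_invariantFunctions, Set.mem_singleton_iff, forall_eq, Equiv.Perm.mul_apply]
  exact ⟨fun H h => by simpa [edgeFlip_edgeFlip] using H (D.edgeFlip h),
    fun H h => by rw [H, edgeFlip_edgeFlip]⟩

/-- The boundary relation at the two ends of an edge, written at the vertex. -/
theorem sub_rotation_of_mem_faceFunctions {f : D.Dart → ℚ} (hf : f ∈ D.faceFunctions) (p : D.End) :
    D.faceBoundary f p = f (D.rotation (p, true)) - f (p, true) ∧
      D.faceBoundary f (D.next.symm p) = f (p, false) - f (D.rotation (p, false)) := by
  rw [mem_faceFunctions] at hf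
  refine ⟨by rw [hf]; rfl, ?_⟩
  rw [hf]
  simp [faceBoundary]

theorem isCycle_faceBoundary {f : D.Dart → ℚ} (hf : f ∈ D.faceFunctions) :
    D.IsCycle (D.faceBoundary f) := by
  refine ⟨fun x => ?_, fun m => ?_⟩
  · rw [(D.sub_rotation_of_mem_faceFunctions hf (Sum.inl (x, true))).2,
      (D.sub_rotation_of_mem_faceFunctions hf (Sum.inl (x, false))).2,
      (D.sub_rotation_of_mem_faceFunctions hf (Sum.inl (x, true))).1,
      (D.sub_rotation_of_mem_faceFunctions hf (Sum.inl (x, false))).1]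
    simp
  · rw [(D.sub_rotation_of_mem_faceFunctions hf (Sum.inr m)).2,
      (D.sub_rotation_of_mem_faceFunctions hf (Sum.inr m)).1]
    simp

theorem finrank_faceBoundaries :
    Module.finrank ℚ (LinearMap.range (D.faceBoundary.domRestrict D.faceFunctions)) +
      Nat.card D.GraphComponent = Nat.card D.Face := by
  have h := LinearMap.finrank_range_add_finrank_ker (D.faceBoundary.domRestrict D.faceFunctions)
  have hmap : (LinearMap.ker (D.faceBoundary.domRestrict D.faceFunctions)).map
      D.faceFunctions.subtype = invariantFunctions {D.rotation, D.edgeFlip} := by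
    ext f
    constructor
    · rintro ⟨⟨f, hf⟩, hk, rfl⟩
      have hflip : ∀ h, f (D.edgeFlip h) = f h := by
        have h0 : ∀ p, f (D.edgeFlip (p, true)) = f (p, true) := fun p =>
          sub_eq_zero.mp (congrFun hk p)
        rintro ⟨p, _ | _⟩
        · have := h0 (D.next.symm p)
          simp only [edgeFlip_true, Equiv.apply_symm_apply] at this
          exact this.symm
        · exact h0 p
      rw [mem_faceFunctions] at hf
      rintro r (rfl | rfl) h
      · exact (hf h).trans (hflip h)
      · exact hflip h
    · intro hf
      have hrot : ∀ h, f (D.rotation h) = f h := hf _ (by simp)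
      have hflip : ∀ h, f (D.edgeFlip h) = f h := hf _ (by simp)
      refine ⟨⟨f, D.mem_faceFunctions.mpr fun h => (hrot h).trans (hflip h).symm⟩, ?_, rfl⟩
      rw [SetLike.mem_coe, LinearMap.mem_ker]
      ext p
      exact sub_eq_zero.mpr (hflip (p, true))
  have h2 : Module.finrank ℚ (LinearMap.ker (D.faceBoundary.domRestrict D.faceFunctions)) =
      Nat.card D.GraphComponent := by
    rw [← finrank_invariantFunctions, ← hmap]
    exact (Submodule.equivMapOfInjective _ D.faceFunctions.injective_subtype _).finrank_eq
  rw [h2, finrank_invariantFunctions] at h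
  exact h

/-- A diagram is planar if and only if every cycle is the boundary of a function on the faces: by
rank-nullity, Euler's formula says that the space of boundaries has the dimension of the space of
cycles. -/
theorem isPlanar_iff : D.IsPlanar ↔
    ∀ z, D.IsCycle z → ∃ f ∈ D.faceFunctions, D.faceBoundary f = z := by
  have hle : LinearMap.range (D.faceBoundary.domRestrict D.faceFunctions) ≤
      LinearMap.ker D.boundaryMatrix.mulVecLin := by
    rintro _ ⟨⟨f, hf⟩, rfl⟩
    exact (D.mem_ker_boundaryMatrix _).mpr (D.isCycle_faceBoundary hf)
  have h1 := D.finrank_cycles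
  have h2 := D.finrank_faceBoundaries
  constructor
  · intro hp z hz
    have heq := Submodule.eq_of_le_of_finrank_eq hle (by unfold IsPlanar at hp; omega)
    obtain ⟨⟨f, hf⟩, rfl⟩ := heq.symm ▸ (D.mem_ker_boundaryMatrix z).mpr hz
    exact ⟨f, hf, rfl⟩
  · intro H
    have heq : LinearMap.range (D.faceBoundary.domRestrict D.faceFunctions) =
        LinearMap.ker D.boundaryMatrix.mulVecLin := by
      refine le_antisymm hle fun z hz => ?_
      obtain ⟨f, hf, rfl⟩ := H z ((D.mem_ker_boundaryMatrix z).mp hz)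
      exact ⟨⟨f, hf⟩, rfl⟩
    rw [heq] at h2
    unfold IsPlanar
    omega

/-! ### Intersection numbers in planar diagrams -/

/-- The algebraic intersection number at the crossing `x` of the edges labeled `0` with the edges
labeled `1`. -/
def crossingNumberAt (L : D.End → Bool) (x : D.X) : ℚ :=
  if D.inLabel L (Sum.inl (x, true)) = L (Sum.inl (x, false)) ∧
      D.inLabel L (Sum.inl (x, false)) = L (Sum.inl (x, true)) then
    if D.inLabel L (Sum.inl (x, true)) = D.inLabel L (Sum.inl (x, false)) then 0
    else if D.inLabel L (Sum.inl (x, true)) = false then 1 else -1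
  else 0

/-- The edges labeled `0` as a flow. -/
def labelFlow (L : D.End → Bool) (p : D.End) : ℚ := if L p then 0 else 1

/-- In the plane the edges labeled `0` and the edges labeled `1` have algebraic intersection
number `0`. The edges labeled `0` bound a function on the faces; summed over the edges labeled `1`,
the differences between its values on the left of consecutive edges cancel. -/
theorem sum_crossingNumberAt (hD : D.IsPlanar) (L : D.End → Bool)
    (hL : D.IsCycle (D.labelFlow L)) : ∑ x, D.crossingNumberAt L x = 0 := by
  obtain ⟨f, hf, hz⟩ := D.isPlanar_iff.mp hD _ hL
  -- `f (D.edgeFlip (p, true))` is the value on the left of the edge `p`.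
  have htel : ∑ p : D.End, ((1 - D.labelFlow L p) * f (D.edgeFlip (p, true)) -
      (1 - D.labelFlow L (D.next.symm p)) * f (p, false)) = 0 := by
    rw [Finset.sum_sub_distrib, ← Equiv.sum_comp D.next fun p =>
      (1 - D.labelFlow L (D.next.symm p)) * f (p, false)]
    simp
  have h1 : ∀ p, D.labelFlow L p = f (D.rotation (p, true)) - f (p, true) := fun p => by
    rw [← hz]; exact (D.sub_rotation_of_mem_faceFunctions hf p).1
  have h2 : ∀ p, D.labelFlow L (D.next.symm p) = f (p, false) - f (D.rotation (p, false)) :=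
    fun p => by rw [← hz]; exact (D.sub_rotation_of_mem_faceFunctions hf p).2
  have hleft : ∀ p, f (D.edgeFlip (p, true)) = f (D.rotation (p, true)) := fun p =>
    (D.mem_faceFunctions.mp hf (p, true)).symm
  rw [Fintype.sum_sum_type, Fintype.sum_prod_type] at htel
  have hm : ∑ m : D.M, ((1 - D.labelFlow L (Sum.inr m)) * f (D.edgeFlip (Sum.inr m, true)) -
      (1 - D.labelFlow L (D.next.symm (Sum.inr m))) * f (Sum.inr m, false)) = 0 := by
    refine Finset.sum_eq_zero fun m _ => ?_
    rw [hL.2 m, hleft]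
    simp
  rw [hm, add_zero] at htel
  rw [← htel]
  refine Finset.sum_congr rfl fun x _ => ?_
  have a1 := h1 (Sum.inl (x, true))
  have a2 := h1 (Sum.inl (x, false))
  have a3 := h2 (Sum.inl (x, true))
  have a4 := h2 (Sum.inl (x, false))
  have hc := hL.1 x
  simp only [Fintype.sum_bool, hleft]
  simp only [rotation_inl, Bool.not_true, Bool.not_false] at a1 a2 a3 a4 ⊢
  simp only [crossingNumberAt, inLabel]
  simp only [labelFlow] at a1 a2 a3 a4 hc ⊢
  rcases Bool.eq_false_or_eq_true (L (D.next.symm (Sum.inl (x, true)))) with b1 | b1 <;>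
    rcases Bool.eq_false_or_eq_true (L (D.next.symm (Sum.inl (x, false)))) with b2 | b2 <;>
    rcases Bool.eq_false_or_eq_true (L (Sum.inl (x, true))) with b3 | b3 <;>
    rcases Bool.eq_false_or_eq_true (L (Sum.inl (x, false))) with b4 | b4 <;>
    simp only [b1, b2, b3, b4] at hc a1 a2 a3 a4 ⊢ <;>
    first | (exfalso; norm_num at hc; done) | (norm_num at a1 a2 a3 a4 ⊢; linarith) | norm_num

end DiagramCode

/-! ### Labeled states -/

namespace DiagramCode.State

variable {D : DiagramCode} {S : D.State} {L : D.End → Bool}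

theorem IsCPair.sgn_ne_zero {x : D.X} (h : S.IsCPair x) : D.sgn x ≠ 0 := h.1

theorem pass_apply (S : D.State) (h : D.Dart) : S.pass h = S.passFun h := rfl

@[simp] theorem pass_inr (S : D.State) (m : D.M) (o : Bool) :
    S.pass (Sum.inr m, o) = (Sum.inr m, !o) := rfl

theorem pass_virtual (S : D.State) {x : D.X} (hx : D.sgn x = 0) (s o : Bool) :
    S.pass (Sum.inl (x, s), o) = (Sum.inl (x, !s), !o) := by
  simp [pass_apply, passFun, hx]

theorem pass_cPair {x : D.X} (hx : S.IsCPair x) (s o : Bool) :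
    S.pass (Sum.inl (x, s), o) = (Sum.inl (x, !s), o) := by
  simp [pass_apply, passFun, hx.sgn_ne_zero, hx]

theorem pass_oriented {x : D.X} (hx : D.sgn x ≠ 0) (hx' : ¬S.IsCPair x) (s o : Bool) :
    S.pass (Sum.inl (x, s), o) = (Sum.inl (x, s), !o) := by
  simp [pass_apply, passFun, hx, hx']

theorem IsLabeling.inr (hL : S.IsLabeling L) (m : D.M) :
    D.inLabel L (Sum.inr m) = L (Sum.inr m) := by
  have := hL (Sum.inr m, true)
  simpa [cusp, dartLabel] using this

theorem IsLabeling.virtual (hL : S.IsLabeling L) {x : D.X} (hx : D.sgn x = 0) (s : Bool) :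
    D.inLabel L (Sum.inl (x, s)) = L (Sum.inl (x, !s)) := by
  have := hL (Sum.inl (x, s), false)
  have hx' : ¬S.IsCPair x := fun h => h.sgn_ne_zero hx
  simp only [pass_virtual S hx, cusp, hx', dartLabel, Bool.not_false, if_false] at this
  simpa [eq_comm] using this

theorem IsLabeling.oriented (hL : S.IsLabeling L) {x : D.X} (hx : D.sgn x ≠ 0)
    (hx' : ¬S.IsCPair x) (s : Bool) : D.inLabel L (Sum.inl (x, s)) = L (Sum.inl (x, s)) := by
  have := hL (Sum.inl (x, s), false)
  simp only [pass_oriented hx hx', cusp, hx', dartLabel, Bool.not_false, if_false] at this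
  simpa [eq_comm] using this

theorem IsLabeling.cPair_in (hL : S.IsLabeling L) {x : D.X} (hx : S.IsCPair x) :
    D.inLabel L (Sum.inl (x, true)) = !D.inLabel L (Sum.inl (x, false)) := by
  have := hL (Sum.inl (x, false), false)
  simp only [pass_cPair hx, cusp, hx, dartLabel, Bool.not_false, if_true] at this
  exact Bool.eq_not.mpr (this.mpr rfl)

theorem IsLabeling.cPair_out (hL : S.IsLabeling L) {x : D.X} (hx : S.IsCPair x) :
    L (Sum.inl (x, true)) = !L (Sum.inl (x, false)) := by
  have := hL (Sum.inl (x, false), true)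
  simp only [pass_cPair hx, cusp, hx, dartLabel, Bool.not_false, if_true] at this
  exact Bool.eq_not.mpr (this.mpr rfl)

/-- The edges labeled `0` form a cycle, since a c-pair has one incoming and one outgoing end labeled
`0`. -/
theorem IsLabeling.isCycle_labelFlow (hL : S.IsLabeling L) : D.IsCycle (D.labelFlow L) := by
  refine ⟨fun x => ?_, fun m => ?_⟩
  · change (if D.inLabel L _ then (0 : ℚ) else 1) + (if D.inLabel L _ then 0 else 1) =
      (if L _ then 0 else 1) + (if L _ then 0 else 1)
    by_cases hx : D.sgn x = 0
    · rw [hL.virtual hx, hL.virtual hx, add_comm]; rfl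
    · by_cases hx' : S.IsCPair x
      · rw [hL.cPair_in hx', hL.cPair_out hx']
        cases D.inLabel L (Sum.inl (x, false)) <;> cases L (Sum.inl (x, false)) <;> simp
      · rw [hL.oriented hx hx', hL.oriented hx hx']
  · change (if D.inLabel L _ then (0 : ℚ) else 1) = if L _ then 0 else 1
    rw [hL.inr]

/-! ### The diagram of a labeled state -/

/-- The ends of `D` are the ends of `λ(S)`. -/
def toLambda (S : D.State) (L : D.End → Bool) : D.End ≃ (S.lambda L).End := S.lambdaEnd L

/-- The darts of `λ(S)` are the darts of `D`. -/
def lambdaDart (S : D.State) (L : D.End → Bool) (h : (S.lambda L).Dart) : D.Dart :=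
  ((S.toLambda L).symm h.1, h.2)

theorem lambda_next (S : D.State) (L : D.End → Bool) (p : D.End) :
    (S.lambda L).next (S.toLambda L p) = S.toLambda L (D.next p) :=
  congrArg (fun q => S.lambdaEnd L (D.next q)) ((S.lambdaEnd L).symm_apply_apply p)

theorem lambda_next_symm (S : D.State) (L : D.End → Bool) (p : D.End) :
    (S.lambda L).next.symm (S.toLambda L p) = S.toLambda L (D.next.symm p) := by
  rw [Equiv.symm_apply_eq, lambda_next, Equiv.apply_symm_apply]

theorem lambdaDart_edgeFlip (S : D.State) (L : D.End → Bool) (h : (S.lambda L).Dart) :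
    S.lambdaDart L ((S.lambda L).edgeFlip h) = D.edgeFlip (S.lambdaDart L h) := by
  obtain ⟨q, o⟩ := h
  obtain ⟨p, rfl⟩ := (S.toLambda L).surjective q
  cases o
  · rw [edgeFlip_false, lambda_next_symm]; simp [lambdaDart]
  · rw [edgeFlip_true, lambda_next]; simp [lambdaDart]

/-- A crossing of `D` that remains, as a crossing of `λ(S)`. -/
def keptCrossing {S : D.State} {L : D.End → Bool} {x : D.X} (hx : S.Keeps L x) :
    (S.lambda L).X := (⟨x, hx⟩ : {x // S.Keeps L x})

/-- A marked point of `λ(S)` on one of the strands that replace a crossing of `D`. -/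
def splitMark {S : D.State} {L : D.End → Bool} {x : D.X} (hx : ¬S.Keeps L x) (s : Bool) :
    (S.lambda L).M := (Sum.inr (⟨x, hx⟩, s) : D.M ⊕ ({x // ¬S.Keeps L x} × Bool))

theorem toLambda_keeps {x : D.X} (hx : S.Keeps L x) (s : Bool) :
    S.toLambda L (Sum.inl (x, s)) = Sum.inl (keptCrossing hx, s) := by
  exact dif_pos hx

theorem toLambda_not_keeps {x : D.X} (hx : ¬S.Keeps L x) (s : Bool) :
    S.toLambda L (Sum.inl (x, s)) = Sum.inr (splitMark hx s) := by
  exact dif_neg hx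

/-- Separating the two strands at some of the crossings of a planar diagram gives a planar diagram:
a cycle of the new diagram is a cycle of the old one, and the function on the faces that it bounds
takes the same value on the two faces that merge. -/
theorem isPlanar_lambda (hD : D.IsPlanar) (S : D.State) (L : D.End → Bool) :
    (S.lambda L).IsPlanar := by
  rw [isPlanar_iff] at hD ⊢
  intro z hz
  have hcyc : D.IsCycle (z ∘ S.toLambda L) := by
    simp only [IsCycle, Function.comp_apply, ← lambda_next_symm]
    refine ⟨fun x => ?_, fun m => hz.2 (Sum.inl m)⟩
    by_cases hx : S.Keeps L x
    · rw [toLambda_keeps hx, toLambda_keeps hx]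
      exact hz.1 (keptCrossing hx)
    · rw [toLambda_not_keeps hx, toLambda_not_keeps hx]
      exact congrArg₂ (· + ·) (hz.2 (splitMark hx true)) (hz.2 (splitMark hx false))
  obtain ⟨f, hf, hfz⟩ := hD _ hcyc
  have hmerge : ∀ x, ¬S.Keeps L x →
      f (Sum.inl (x, false), false) = f (Sum.inl (x, true), true) := by
    intro x hx
    have h := hz.2 (splitMark hx true)
    rw [← toLambda_not_keeps hx true, lambda_next_symm] at h
    change (z ∘ S.toLambda L) (D.next.symm _) = (z ∘ S.toLambda L) _ at h
    rw [← hfz, (D.sub_rotation_of_mem_faceFunctions hf (Sum.inl (x, true))).2,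
      (D.sub_rotation_of_mem_faceFunctions hf (Sum.inl (x, true))).1] at h
    simpa using h
  have hrot := D.mem_faceFunctions.mp hf
  refine ⟨f ∘ S.lambdaDart L, ?_, ?_⟩
  · rw [mem_faceFunctions]
    intro h
    simp only [Function.comp_apply, lambdaDart_edgeFlip, ← hrot]
    rcases h with ⟨⟨x, s⟩ | m | ⟨⟨x, hx⟩, s⟩, o⟩
    · rfl
    · rfl
    · change f (Sum.inl (x, s), !o) = f (Sum.inl (x, o), !s)
      have := hmerge x hx
      cases s <;> cases o <;> simp [this]
  · ext q
    obtain ⟨p, rfl⟩ := (S.toLambda L).surjective q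
    have := congrFun hfz p
    simp only [faceBoundary, LinearMap.coe_mk, AddHom.coe_mk, Function.comp_apply,
      lambdaDart_edgeFlip] at this ⊢
    simpa [lambdaDart] using this

theorem isClassical_lambda (hD : D.IsPlanar) (S : D.State) (L : D.End → Bool) :
    (S.lambda L).IsClassical := by
  refine ⟨isPlanar_lambda hD S L, fun x => ?_⟩
  change S.lambdaSgn L x ≠ 0
  unfold lambdaSgn
  split_ifs <;> decide

theorem lambda_inLabel (S : D.State) (L : D.End → Bool) (p : D.End) :
    (S.lambda L).inLabel (S.lambdaLabel L) (S.toLambda L p) = D.inLabel L p := by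
  rw [inLabel, lambda_next_symm]
  exact congrArg L ((S.lambdaEnd L).symm_apply_apply _)

theorem lambda_inLabel_inl {x : D.X} (hx : S.Keeps L x) (s : Bool) :
    (S.lambda L).inLabel (S.lambdaLabel L) (Sum.inl (keptCrossing hx, s)) =
      D.inLabel L (Sum.inl (x, s)) := by
  rw [← toLambda_keeps hx, lambda_inLabel]

theorem lambda_sgn_kept {x : D.X} (hx : S.Keeps L x) :
    (S.lambda L).sgn (keptCrossing hx) =
      if D.sgn x = 0 then
        if D.inLabel L (Sum.inl (x, true)) = false ∧ D.inLabel L (Sum.inl (x, false)) = true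
        then -1 else 1
      else
        if D.inLabel L (Sum.inl (x, true)) = false then 1 else -1 := rfl

theorem cPairSign_kept {x : D.X} (hx : S.Keeps L x) :
    S.cPairSign L x = ((S.lambda L).sgn (keptCrossing hx) : ℤ) := dif_pos hx

theorem cPairSign_not_kept {x : D.X} (hx : ¬S.Keeps L x) : S.cPairSign L x = 0 := dif_neg hx

/-- The summand of `Lk(i, j)` at a crossing of `λ(S)`, in terms of `D`. -/
theorem lambda_linking_summand {x : D.X} (hx : S.Keeps L x) (i j : Bool) :
    (if (S.lambda L).overLabel (S.lambdaLabel L) (keptCrossing hx) = i ∧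
        (S.lambda L).underLabel (S.lambdaLabel L) (keptCrossing hx) = j
      then ((S.lambda L).sgn (keptCrossing hx) : ℤ) else 0) =
    if D.inLabel L (Sum.inl (x, decide ((S.lambda L).sgn (keptCrossing hx) = 1))) = i ∧
        D.inLabel L (Sum.inl (x, !decide ((S.lambda L).sgn (keptCrossing hx) = 1))) = j
      then ((S.lambda L).sgn (keptCrossing hx) : ℤ) else 0 := by
  rw [overLabel, underLabel, lambda_inLabel_inl, lambda_inLabel_inl]

theorem IsLabeling.keeps_label (hL : S.IsLabeling L) {x : D.X} (hx : S.Keeps L x) (s : Bool) :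
    D.inLabel L (Sum.inl (x, s)) = L (Sum.inl (x, !s)) := by
  rcases hx with hx | ⟨hx, h⟩
  · exact hL.virtual hx s
  · cases s
    · rw [← Bool.not_inj_iff, ← hL.cPair_in hx, h, Bool.not_false, hL.cPair_out hx, Bool.not_not]
    · exact h

/-- The contribution of the crossing `x`, if it is virtual, to `Lk(1, 0)`. -/
def virtualLinkingAt (D : DiagramCode) (L : D.End → Bool) (x : D.X) : ℤ :=
  if D.sgn x = 0 then
    if D.inLabel L (Sum.inl (x, true)) = D.inLabel L (Sum.inl (x, false)) then 0
    else if D.inLabel L (Sum.inl (x, true)) = false then -1 else 1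
  else 0

/-- At every c-pair the strand `0` crosses over the strand `1`, at a virtual crossing it never
does. -/
theorem IsLabeling.cPairSum_eq (hL : S.IsLabeling L) :
    S.cPairSum L = S.lambdaLinking L false true := by
  symm
  refine Fintype.sum_of_injective Subtype.val Subtype.val_injective _ _ ?_ ?_
  · intro x hx
    have hx' : ¬S.Keeps L x := fun h => hx ⟨⟨x, h⟩, rfl⟩
    simp [cPairSign_not_kept hx']
  · rintro ⟨x, hk⟩
    refine (lambda_linking_summand hk false true).trans ?_
    rw [cPairSign_kept hk, lambda_sgn_kept hk]
    by_cases hx : D.sgn x = 0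
    · have hx' : ¬S.IsCPair x := fun h => h.sgn_ne_zero hx
      cases h1 : D.inLabel L (Sum.inl (x, true)) <;>
        cases h2 : D.inLabel L (Sum.inl (x, false)) <;> simp [hx, hx', h1, h2]
    · have hx' : S.IsCPair x := (hk.resolve_left hx).1
      have h1 := hL.cPair_in hx'
      cases h2 : D.inLabel L (Sum.inl (x, false)) <;> rw [h2] at h1 <;>
        simp [hx, hx', h1, h2]

theorem IsLabeling.lambdaLinking_true_false (hL : S.IsLabeling L) :
    S.lambdaLinking L true false = ∑ x, virtualLinkingAt D L x := by
  refine Fintype.sum_of_injective Subtype.val Subtype.val_injective _ _ ?_ ?_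
  · intro x hx
    have hx' : ¬S.Keeps L x := fun h => hx ⟨⟨x, h⟩, rfl⟩
    have : D.sgn x ≠ 0 := fun h => hx' (Or.inl h)
    simp [virtualLinkingAt, this]
  · rintro ⟨x, hk⟩
    refine (lambda_linking_summand hk true false).trans ?_
    rw [lambda_sgn_kept hk, virtualLinkingAt]
    by_cases hx : D.sgn x = 0
    · cases h1 : D.inLabel L (Sum.inl (x, true)) <;>
        cases h2 : D.inLabel L (Sum.inl (x, false)) <;> simp [hx, h1, h2]
    · have hx' : S.IsCPair x := (hk.resolve_left hx).1
      have h1 := hL.cPair_in hx'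
      cases h2 : D.inLabel L (Sum.inl (x, false)) <;> rw [h2] at h1 <;>
        simp [hx, h1, h2]

theorem IsLabeling.crossingNumberAt_eq (hL : S.IsLabeling L) (x : D.X) :
    D.crossingNumberAt L x = (((if S.IsCPair x then S.cPairSign L x else 0) -
      virtualLinkingAt D L x : ℤ) : ℚ) := by
  unfold crossingNumberAt virtualLinkingAt
  by_cases hx : D.sgn x = 0
  · have hx' : ¬S.IsCPair x := fun h => h.sgn_ne_zero hx
    have h1 := hL.virtual hx true
    have h2 := hL.virtual hx false
    rw [Bool.not_true] at h1
    rw [Bool.not_false] at h2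
    rw [if_pos ⟨h1, h2⟩, if_neg hx', if_pos hx]
    split_ifs <;> simp
  · rw [if_neg hx]
    by_cases hx' : S.IsCPair x
    · have h1 := hL.cPair_in hx'
      by_cases hk : S.Keeps L x
      · rw [if_pos ⟨hL.keeps_label hk true, hL.keeps_label hk false⟩, if_pos hx',
          cPairSign_kept hk, lambda_sgn_kept hk]
        cases h2 : D.inLabel L (Sum.inl (x, false)) <;> rw [h2] at h1 <;>
          simp [hx, h1]
      · have hn : ¬D.inLabel L (Sum.inl (x, true)) = L (Sum.inl (x, false)) := fun h =>
          hk (Or.inr ⟨hx', h⟩)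
        rw [if_neg fun h => hn h.1, cPairSign_not_kept hk]
        simp
    · rw [if_neg hx', hL.oriented hx hx', hL.oriented hx hx']
      cases L (Sum.inl (x, true)) <;> cases L (Sum.inl (x, false)) <;> simp

theorem IsLabeling.lambdaLinking_comm (hL : S.IsLabeling L) (hD : D.IsPlanar) :
    S.lambdaLinking L false true = S.lambdaLinking L true false := by
  have h := D.sum_crossingNumberAt hD L hL.isCycle_labelFlow
  simp only [hL.crossingNumberAt_eq] at h
  rw [← Int.cast_sum, Int.cast_eq_zero, Finset.sum_sub_distrib, sub_eq_zero] at h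
  rw [← hL.cPairSum_eq, hL.lambdaLinking_true_false]
  exact h

theorem IsLabeling.abs_lambdaLinking_le (hL : S.IsLabeling L) :
    |S.lambdaLinking L true false| ≤ (D.numVirtual : ℤ) := by
  rw [hL.lambdaLinking_true_false, numVirtual, Fintype.card_subtype, Finset.card_eq_sum_ones,
    Finset.sum_filter]
  push_cast
  refine (Finset.abs_sum_le_sum_abs _ _).trans (Finset.sum_le_sum fun x _ => ?_)
  unfold virtualLinkingAt
  split_ifs <;> simp

end DiagramCode.State

/-! ### Weighted orbits -/

/-- The orbits of a self-map, i.e. the components of its functional graph. -/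
abbrev MapOrbit {P : Type} (t : P → P) : Type := Quot fun p q => t p = q

namespace MapOrbit

variable {P Q : Type} {t : P → P}

theorem mk_apply (t : P → P) (p : P) : (Quot.mk _ (t p) : MapOrbit t) = Quot.mk _ p :=
  (Quot.sound (r := fun p q => t p = q) rfl).symm

theorem mk_iterate (t : P → P) (p : P) (n : ℕ) :
    (Quot.mk _ (t^[n] p) : MapOrbit t) = Quot.mk _ p := by
  induction n with
  | zero => rfl
  | succ n ih => rw [Function.iterate_succ_apply', mk_apply, ih]

/-- The total weight of an orbit. -/
noncomputable def weight [Fintype P] (κ : P → ℤ) (O : MapOrbit t) : ℤ := by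
  classical exact ∑ p, if Quot.mk _ p = O then κ p else 0

/-- The absolute values of the weights of the orbits. -/
noncomputable def weights [Fintype P] (t : P → P) (κ : P → ℤ) : Multiset ℕ := by
  classical
  have := Fintype.ofFinite (MapOrbit t)
  exact (Finset.univ : Finset (MapOrbit t)).val.map fun O => (weight κ O).natAbs

theorem weights_eq [Fintype P] [Fintype (MapOrbit t)] (κ : P → ℤ) :
    weights t κ =
      (Finset.univ : Finset (MapOrbit t)).val.map fun O => (weight κ O).natAbs := by
  unfold weights
  congr!

theorem card_weights [Fintype P] (t : P → P) (κ : P → ℤ) :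
    Multiset.card (weights t κ) = Nat.card (MapOrbit t) := by
  have := Fintype.ofFinite (MapOrbit t)
  rw [weights_eq, Multiset.card_map, Nat.card_eq_fintype_card]
  rfl

theorem weights_congr [Fintype P] [Fintype Q] {t' : Q → Q} {κ : P → ℤ} {κ' : Q → ℤ}
    (e : MapOrbit t' ≃ MapOrbit t) (he : ∀ O, weight κ (e O) = weight κ' O) :
    weights t κ = weights t' κ' := by
  have := Fintype.ofFinite (MapOrbit t)
  have := Fintype.ofFinite (MapOrbit t')
  rw [weights_eq, weights_eq, ← Finset.map_univ_equiv e, Finset.map_val, Multiset.map_map]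
  exact Multiset.map_congr rfl fun O _ => congrArg Int.natAbs (he O)

/-- First return. If every point of `P` reaches the image of `ι` under `t`, and `t'` is the first
return map, then `t` and `t'` have the same orbits. Here `g p` is the first point of `Q` that `p`
reaches and `φ p` the weight that is collected before. The weights of `t` and `t'` differ by a
coboundary. -/
theorem weights_firstReturn [Fintype P] [Fintype Q] (t : Equiv.Perm P) (t' : Q → Q) (κ : P → ℤ)
    (κ' : Q → ℤ) (ι : Q → P) (g : P → Q) (φ : P → ℤ) (hg : ∀ q, g (ι q) = q)
    (hφ : ∀ q, φ (ι q) = 0)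
    (hstep : ∀ p, p ∉ Set.range ι → g (t p) = g p ∧ φ p = κ p + φ (t p))
    (hret : ∀ q, g (t (ι q)) = t' q ∧ κ' q = κ (ι q) + φ (t (ι q)))
    (hreach : ∀ p, ∃ n, t^[n] p ∈ Set.range ι) : weights t κ = weights t' κ' := by
  classical
  have hι : Function.Injective ι := Function.LeftInverse.injective hg
  have hmk : ∀ n p, t^[n] p ∈ Set.range ι →
      (Quot.mk _ (ι (g p)) : MapOrbit t) = Quot.mk _ p := by
    intro n
    induction n with
    | zero =>
      rintro p ⟨q, hq⟩
      rw [Function.iterate_zero_apply] at hq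
      rw [← hq, hg]
    | succ n ih =>
      intro p hp
      by_cases hpr : p ∈ Set.range ι
      · obtain ⟨q, rfl⟩ := hpr
        rw [hg]
      · rw [← (hstep p hpr).1, ih (t p) hp, mk_apply]
  have hmk' : ∀ p, (Quot.mk _ (ι (g p)) : MapOrbit t) = Quot.mk _ p := fun p =>
    (hreach p).elim fun n hn => hmk n p hn
  let e : MapOrbit t' ≃ MapOrbit t :=
    { toFun := Quot.lift (fun q => Quot.mk _ (ι q)) (by
        rintro q _ rfl
        rw [← (hret q).1, hmk', mk_apply])
      invFun := Quot.lift (fun p => Quot.mk _ (g p)) (by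
        rintro p _ rfl
        by_cases hp : p ∈ Set.range ι
        · obtain ⟨q, rfl⟩ := hp
          rw [hg, (hret q).1, mk_apply]
        · rw [(hstep p hp).1])
      left_inv := by
        rintro ⟨q⟩
        exact congrArg (Quot.mk _) (hg q)
      right_inv := by
        rintro ⟨p⟩
        exact hmk' p }
  refine weights_congr e fun O => ?_
  -- `κ` is the weight `κ'`, extended by zero, plus the coboundary of `φ`.
  have hκ : ∀ p, κ p = (∑ q, if ι q = p then κ' q else 0) + φ p - φ (t p) := by
    intro p
    by_cases hp : p ∈ Set.range ι
    · obtain ⟨q, rfl⟩ := hp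
      have : ∀ q', (ι q' = ι q) = (q' = q) := fun q' => propext hι.eq_iff
      simp only [this, Finset.sum_ite_eq', Finset.mem_univ, if_true]
      rw [hφ, (hret q).2]
      ring
    · rw [Finset.sum_eq_zero, (hstep p hp).2]
      · ring
      · intro q _
        rw [if_neg fun h => hp ⟨q, h⟩]
  have hcob : ∑ p, (if Quot.mk _ p = e O then φ (t p) else 0) =
      ∑ p, if Quot.mk _ p = e O then φ p else 0 := by
    rw [← Equiv.sum_comp t fun p => if (Quot.mk _ p : MapOrbit t) = e O then φ p else 0]
    simp only [mk_apply]
  have hO : ∀ q : Q, (Quot.mk _ (ι q) : MapOrbit t) = e O ↔ Quot.mk _ q = O := fun q =>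
    e.injective.eq_iff (a := Quot.mk _ q) (b := O)
  have hsplit : ∀ p, (if (Quot.mk _ p : MapOrbit t) = e O then κ p else 0) =
      (∑ q, if ι q = p then (if Quot.mk _ q = O then κ' q else 0) else 0) +
        (if Quot.mk _ p = e O then φ p else 0) - if Quot.mk _ p = e O then φ (t p) else 0 := by
    intro p
    have : (∑ q, if ι q = p then (if Quot.mk _ q = O then κ' q else 0) else 0) =
        if (Quot.mk _ p : MapOrbit t) = e O then ∑ q, (if ι q = p then κ' q else 0) else 0 := by
      have : (if (Quot.mk _ p : MapOrbit t) = e O then ∑ q, (if ι q = p then κ' q else 0) else 0) =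
          ∑ q, if (Quot.mk _ p : MapOrbit t) = e O then (if ι q = p then κ' q else 0) else 0 := by
        split_ifs <;> simp
      rw [this]
      refine Finset.sum_congr rfl fun q _ => ?_
      by_cases hq : ι q = p
      · subst hq
        simp only [hO, if_true]
      · simp only [hq, if_false, ite_self]
    rw [this]
    split_ifs
    · exact hκ p
    · simp
  unfold weight
  rw [Finset.sum_congr rfl fun p _ => hsplit p, Finset.sum_sub_distrib, Finset.sum_add_distrib,
    hcob, add_sub_cancel_right, Finset.sum_comm]
  simp

theorem weight_sum_eq [Fintype P] [Fintype (MapOrbit t)] (κ : P → ℤ) (ε : MapOrbit t → ℤ) :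
    ∑ p, ε (Quot.mk _ p) * κ p = ∑ O, ε O * weight κ O := by
  classical
  simp only [weight, Finset.mul_sum]
  rw [Finset.sum_comm]
  simp

/-- Orbits of a disjoint union with the identity on points of weight zero. -/
theorem weights_sum_id [Fintype P] [Fintype Q] (t : P → P) (κ : P → ℤ) :
    weights (Sum.map t (id : Q → Q)) (Sum.elim κ fun _ => 0) =
      weights t κ + Multiset.replicate (Fintype.card Q) 0 := by
  classical
  have := Fintype.ofFinite (MapOrbit t)
  let e : MapOrbit (Sum.map t (id : Q → Q)) ≃ MapOrbit t ⊕ Q :=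
    { toFun := Quot.lift (Sum.map (Quot.mk _) id) (by
        rintro (p | q) _ rfl
        · exact congrArg Sum.inl (mk_apply t p).symm
        · rfl)
      invFun := Sum.elim (Quot.lift (fun p => Quot.mk _ (Sum.inl p)) (by
        rintro p _ rfl
        exact (mk_apply (Sum.map t (id : Q → Q)) (Sum.inl p)).symm)) fun q => Quot.mk _ (Sum.inr q)
      left_inv := by rintro ⟨p | q⟩ <;> rfl
      right_inv := by
        rintro (O | q)
        · exact Quot.inductionOn O fun p => rfl
        · rfl }
  have := Fintype.ofEquiv _ e.symm
  have k1 : ∀ p O, (Quot.mk _ (Sum.inl p) = e.symm (Sum.inl O)) = (Quot.mk _ p = O) := fun p O =>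
    propext (e.eq_symm_apply.trans Sum.inl_injective.eq_iff)
  have k2 : ∀ p q, (Quot.mk _ (Sum.inl p) = e.symm (Sum.inr q)) = False := fun p q =>
    propext (e.eq_symm_apply.trans (by simp [e]))
  have h1 : ∀ O : MapOrbit t, weight (Sum.elim κ fun _ => 0) (e.symm (Sum.inl O)) = weight κ O := by
    intro O
    unfold weight
    rw [Fintype.sum_sum_type]
    simp [k1]
  have h2 : ∀ q : Q, weight (Sum.elim κ fun _ => 0) (e.symm (Sum.inr q)) = 0 := by
    intro q
    unfold weight
    rw [Fintype.sum_sum_type]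
    simp [k2]
  rw [weights_eq, weights_eq, ← Finset.map_univ_equiv e.symm, Finset.map_val, Multiset.map_map,
    ← Finset.univ_disjSum_univ, Finset.val_disjSum, Multiset.disjSum, Multiset.map_add,
    Multiset.map_map, Multiset.map_map]
  congr 1
  · exact Multiset.map_congr rfl fun O _ => congrArg Int.natAbs (h1 O)
  · rw [Multiset.eq_replicate]
    refine ⟨by rw [Multiset.card_map]; rfl, ?_⟩
    intro n hn
    obtain ⟨q, _, rfl⟩ := Multiset.mem_map.mp hn
    exact congrArg Int.natAbs (h2 q)

end MapOrbit

/-! ### Loops generated by two involutions -/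

namespace MapOrbit

variable {P : Type}

theorem mk_eq_mk_iff {t : Equiv.Perm P} {p q : P} :
    (Quot.mk _ p : MapOrbit t) = Quot.mk _ q ↔ t.SameCycle p q := by
  constructor
  · intro h
    let F : MapOrbit t → Quotient (Equiv.Perm.SameCycle.setoid t) :=
      Quot.lift (fun p => Quotient.mk _ p) fun a b hab =>
        Quotient.sound (s := Equiv.Perm.SameCycle.setoid t) ⟨1, by simpa using hab⟩
    exact Quotient.exact (congrArg F h)
  · rintro ⟨n, rfl⟩
    induction n using Int.induction_on with
    | zero => rfl
    | succ n ih => rw [zpow_add_one, (Commute.refl t).zpow_left n |>.eq, Equiv.Perm.mul_apply,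
        mk_apply, ih]
    | pred n ih =>
      rw [← mk_apply t ((t ^ (-(n : ℤ) - 1)) p), ← Equiv.Perm.mul_apply, ← zpow_one_add,
        add_sub_cancel, ih]

variable (a b : Equiv.Perm P)

/-- Two permutations of order two without fixed points: the joining of the half edges along the
edges, and through the vertices. -/
structure IsJoining : Prop where
  left : ∀ p, a (a p) = p
  right : ∀ p, b (b p) = p
  left_ne : ∀ p, a p ≠ p
  right_ne : ∀ p, b p ≠ p

variable {a b}

/-- A tour never comes back in the opposite direction. -/
theorem IsJoining.iterate_ne (H : IsJoining a b) (n : ℕ) : ∀ p, (a * b)^[n] p ≠ a p := by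
  induction n using Nat.twoStepInduction with
  | zero => exact fun p h => H.left_ne p h.symm
  | one => exact fun p h => H.right_ne p (a.injective h)
  | more n ih _ =>
    intro p h
    refine ih ((a * b) p) ?_
    rw [Function.iterate_succ_apply', Function.iterate_succ_apply] at h
    have h1 := a.injective h
    rw [Equiv.Perm.mul_apply, H.left, ← H.right ((a * b)^[n] _)]
    exact congrArg b h1

theorem IsJoining.mk_left_ne (H : IsJoining a b) [Finite P] (p : P) :
    (Quot.mk _ (a p) : MapOrbit (a * b)) ≠ Quot.mk _ p := by
  intro h
  obtain ⟨n, -, hn⟩ := (mk_eq_mk_iff.mp h.symm).exists_pow_eq'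
  exact H.iterate_ne n p (by rw [← Equiv.Perm.coe_pow]; exact hn)

theorem IsJoining.mk_right (H : IsJoining a b) (p : P) :
    (Quot.mk _ (b p) : MapOrbit (a * b)) = Quot.mk _ (a p) := by
  rw [← mk_apply]
  exact congrArg (Quot.mk _) (by rw [Equiv.Perm.mul_apply, H.right])

/-- The tour in the opposite direction. -/
def IsJoining.reverse (H : IsJoining a b) : MapOrbit (a * b) → MapOrbit (a * b) :=
  Quot.lift (fun p => Quot.mk _ (a p)) (by
    intro p q hq
    rw [← hq, Equiv.Perm.mul_apply, H.left, H.mk_right])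

theorem IsJoining.reverse_mk_right (H : IsJoining a b) (p : P) :
    H.reverse (Quot.mk _ p) = Quot.mk _ (b p) := (H.mk_right p).symm

theorem IsJoining.reverse_reverse (H : IsJoining a b) (O : MapOrbit (a * b)) :
    H.reverse (H.reverse O) = O := by
  induction O using Quot.inductionOn with
  | h p => exact congrArg (Quot.mk _) (H.left p)

theorem IsJoining.reverse_ne (H : IsJoining a b) [Finite P] (O : MapOrbit (a * b)) :
    H.reverse O ≠ O := by
  induction O using Quot.inductionOn with
  | h p => exact H.mk_left_ne p

theorem IsJoining.weight_reverse (H : IsJoining a b) [Fintype P] {κ : P → ℤ}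
    (hκ : ∀ p, κ (b p) = -κ p) (O : MapOrbit (a * b)) : weight κ (H.reverse O) = -weight κ O := by
  classical
  unfold weight
  rw [← Equiv.sum_comp b, ← Finset.sum_neg_distrib]
  refine Finset.sum_congr rfl fun p _ => ?_
  rw [← H.reverse_mk_right, (Function.LeftInverse.injective H.reverse_reverse).eq_iff, hκ]
  split_ifs <;> simp

/-- One of the two directions of every loop can be chosen. -/
theorem IsJoining.exists_direction (H : IsJoining a b) [Finite P] :
    ∃ c : MapOrbit (a * b) → Bool, ∀ O, c (H.reverse O) = !c O := by
  let e := Finite.equivFin (MapOrbit (a * b))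
  refine ⟨fun O => decide (e O < e (H.reverse O)), fun O => ?_⟩
  simp only [H.reverse_reverse]
  have : e (H.reverse O) ≠ e O := fun h => H.reverse_ne O (e.injective h)
  by_cases h : e O < e (H.reverse O)
  · rw [decide_eq_true h, decide_eq_false (not_lt.mpr h.le)]; rfl
  · rw [decide_eq_false h, decide_eq_true (lt_of_le_of_ne (not_lt.mp h) this)]; rfl

theorem IsJoining.mk_eq_or (H : IsJoining a b) {p q : P}
    (h : (Quotient.mk _ p : OrbitSet {a, b}) = Quotient.mk _ q) :
    (Quot.mk _ p : MapOrbit (a * b)) = Quot.mk _ q ∨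
      (Quot.mk _ p : MapOrbit (a * b)) = H.reverse (Quot.mk _ q) := by
  -- The unordered pair of the two directions is an invariant of the loop.
  let u : P → Sym2 (MapOrbit (a * b)) := fun p => s(Quot.mk _ p, H.reverse (Quot.mk _ p))
  have hu : ∀ g ∈ ({a, b} : Set (Equiv.Perm P)), ∀ p, u (g p) = u p := by
    rintro g (rfl | rfl) p
    · change s(H.reverse (Quot.mk _ p), H.reverse (H.reverse (Quot.mk _ p))) = _
      rw [H.reverse_reverse, Sym2.eq_swap]
    · simp only [u]
      rw [← H.reverse_mk_right, H.reverse_reverse, Sym2.eq_swap]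
  obtain ⟨⟨g, hg⟩, hgq⟩ := Quotient.exact h
  have hp : u p = u q := by
    rw [← hgq]
    exact apply_closure_eq hu hg q
  rcases Sym2.eq_iff.mp hp with h | h
  · exact Or.inl h.1
  · exact Or.inr h.1

theorem mk_loop_left (p : P) :
    (Quotient.mk _ (a p) : OrbitSet {a, b}) = Quotient.mk _ p :=
  orbitSet_mk_apply (by simp) p

/-- The loop that a tour describes. -/
def loop : MapOrbit (a * b) → OrbitSet {a, b} :=
  Quot.lift (fun p => Quotient.mk _ p) (by
    intro p q hq
    rw [← hq, Equiv.Perm.mul_apply, orbitSet_mk_apply (by simp), orbitSet_mk_apply (by simp)])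

theorem IsJoining.eq_or_of_loop_eq (H : IsJoining a b) {O O' : MapOrbit (a * b)}
    (h : loop O = loop O') : O = O' ∨ O = H.reverse O' := by
  induction O using Quot.inductionOn with
  | h p =>
    induction O' using Quot.inductionOn with
    | h q => exact H.mk_eq_or h

/-- Every loop can be toured in exactly two directions. -/
theorem IsJoining.bijective_loop (H : IsJoining a b) {c : MapOrbit (a * b) → Bool}
    (hc : ∀ O, c (H.reverse O) = !c O) : Function.Bijective fun O => (loop O, c O) := by
  constructor
  · intro O O' h
    obtain ⟨h1, h2⟩ := Prod.mk.inj h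
    rcases H.eq_or_of_loop_eq h1 with h | h
    · exact h
    · rw [h, hc] at h2
      simp at h2
  · rintro ⟨C, i⟩
    induction C using Quotient.inductionOn with
    | h p =>
      by_cases h : c (Quot.mk _ p) = i
      · exact ⟨Quot.mk _ p, Prod.ext rfl h⟩
      · refine ⟨H.reverse (Quot.mk _ p), Prod.ext (mk_loop_left p) ?_⟩
        refine (hc _).trans ?_
        exact (Bool.eq_not.mpr (Ne.symm h)).symm

theorem IsJoining.sum_loop (H : IsJoining a b) [Fintype P] [Fintype (MapOrbit (a * b))]
    [Fintype (OrbitSet {a, b})] {M : Type} [AddCommMonoid M] (m : OrbitSet {a, b} → M) :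
    ∑ O, m (loop O) = 2 • ∑ C, m C := by
  obtain ⟨c, hc⟩ := H.exists_direction
  rw [(H.bijective_loop hc).sum_comp fun x => m x.1, Fintype.sum_prod_type]
  simp [Finset.sum_nsmul]

theorem IsJoining.even_card (H : IsJoining a b) [Finite P] :
    Even (Nat.card (MapOrbit (a * b : Equiv.Perm P))) := by
  obtain ⟨c, hc⟩ := H.exists_direction
  rw [Nat.card_congr (Equiv.ofBijective _ (H.bijective_loop hc)), Nat.card_prod]
  simp

theorem IsJoining.weights_eq_two_nsmul (H : IsJoining a b) [Fintype P] [Fintype (OrbitSet {a, b})]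
    {κ : P → ℤ} {m : OrbitSet {a, b} → ℕ} (hm : ∀ p, m (Quotient.mk _ p) =
      (weight κ (Quot.mk _ p : MapOrbit (a * b))).natAbs) :
    weights (a * b : Equiv.Perm P) κ = 2 • (Finset.univ.val.map m) := by
  have := Fintype.ofFinite (MapOrbit (a * b))
  have h1 : ∀ O : MapOrbit (a * b), (weight κ O).natAbs = m (loop O) := by
    intro O
    induction O using Quot.inductionOn with
    | h p => exact (hm p).symm
  rw [weights_eq, Multiset.map_congr rfl fun O _ => h1 O]
  have h2 := H.sum_loop fun C => ({m C} : Multiset ℕ)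
  have h3 : ∀ {ι : Type} [Fintype ι] (f : ι → ℕ),
      Finset.univ.val.map f = ∑ i, ({f i} : Multiset ℕ) := by
    intro ι _ f
    have h4 := Multiset.sum_map_singleton (Finset.univ.val.map f)
    rw [Multiset.map_map] at h4
    exact h4.symm
  rw [h3, h3, h2]

end MapOrbit

/-! ### Alternating sums of cyclic words -/

/-- The alternating sum of a word of sides. -/
def altSum : List Bool → ℤ
  | [] => 0
  | b :: l => (if b then 1 else -1) - altSum l

theorem altSum_append (l l' : List Bool) :
    altSum (l ++ l') = altSum l + (-1) ^ l.length * altSum l' := by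
  induction l with
  | nil => simp [altSum]
  | cons b l ih => simp only [List.cons_append, altSum, ih, List.length_cons, pow_succ]; ring

theorem natAbs_altSum_le (l : List Bool) : (altSum l).natAbs ≤ l.length := by
  induction l with
  | nil => simp [altSum]
  | cons b l ih =>
    simp only [altSum, List.length_cons]
    split_ifs <;> omega

theorem even_altSum (l : List Bool) (hl : Even l.length) : Even (altSum l) := by
  suffices h : (altSum l + l.length) % 2 = 0 by
    obtain ⟨n, hn⟩ := hl
    rw [Int.even_iff]
    omega
  clear hl
  induction l with
  | nil => simp [altSum]
  | cons b l ih =>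
    simp only [altSum, List.length_cons]
    split_ifs <;> push_cast <;> omega

/-- For a word of even length the absolute value of the alternating sum belongs to the cyclic
word. -/
theorem natAbs_altSum_eq_of_isRotated {l l' : List Bool} (h : l ~r l') (hl : Even l.length) :
    (altSum l').natAbs = (altSum l).natAbs := by
  obtain ⟨n, rfl⟩ := h
  induction n with
  | zero => simp
  | succ n ih =>
    rw [← ih, ← List.rotate_rotate]
    have hn : Even (l.rotate n).length := by simpa using hl
    generalize l.rotate n = w at hn
    rcases w with _ | ⟨b, w⟩
    · simp
    · rw [List.rotate_cons_succ, List.rotate_zero, altSum_append]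
      have hw : Odd w.length := by
        rw [List.length_cons, Nat.even_add_one] at hn
        exact Nat.not_even_iff_odd.mp hn
      rw [hw.neg_one_pow]
      simp only [altSum]
      omega

/-- Cancellations do not change the alternating sum. -/
theorem natAbs_altSum_of_cancel {l : List Bool} (hl : Even l.length) {w : Cycle Bool}
    (h : Relation.ReflTransGen CuspCancel (l : Cycle Bool) w) :
    ∃ l' : List Bool, w = l' ∧ Even l'.length ∧ (altSum l').natAbs = (altSum l).natAbs := by
  induction h with
  | refl => exact ⟨l, rfl, hl, rfl⟩
  | tail _ hs ih =>
    obtain ⟨l', hw, he, ha⟩ := ih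
    cases hs with
    | cancel b l₂ =>
      have hr : l' ~r (b :: b :: l₂) := Cycle.coe_eq_coe.mp hw.symm
      have h1 := natAbs_altSum_eq_of_isRotated hr he
      have h2 := hr.perm.length_eq
      refine ⟨l₂, rfl, ?_, ?_⟩
      · rw [h2, List.length_cons, List.length_cons] at he
        simpa [Nat.even_add_one] using he
      · rw [← ha, ← h1]
        simp [altSum]

theorem natAbs_altSum_of_isChain {l : List Bool} (h : l.IsChain (· ≠ ·)) :
    (altSum l).natAbs = l.length := by
  suffices H : ∀ (l : List Bool) (b : Bool), (b :: l).IsChain (· ≠ ·) →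
      altSum (b :: l) = (if b then 1 else -1) * (l.length + 1) by
    rcases l with _ | ⟨b, l⟩
    · rfl
    · rw [H l b h]
      simp only [List.length_cons]
      split_ifs <;> omega
  intro l
  induction l with
  | nil => intro b _; simp [altSum]
  | cons b' l ih =>
    intro b h
    rw [List.isChain_cons_cons] at h
    rw [altSum, ih b' h.2]
    have := h.1
    cases b <;> cases b' <;> simp at this ⊢ <;> ring

/-- Every cyclic word of even length reduces to one whose length is its alternating sum. -/
theorem exists_reduced (n : ℕ) : ∀ l : List Bool, l.length = n → Even n →
    ∃ w : Cycle Bool, Relation.ReflTransGen CuspCancel (l : Cycle Bool) w ∧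
      w.length = (altSum l).natAbs := by
  induction n using Nat.strong_induction_on with
  | _ n ih =>
    intro l hl hn
    by_cases hc : l.IsChain (· ≠ ·)
    · exact ⟨l, .refl, (natAbs_altSum_of_isChain hc).symm⟩
    · have : ∃ l₁ l₂ b, l = l₁ ++ b :: b :: l₂ := by
        clear ih hl
        induction l with
        | nil => simp at hc
        | cons b l ihl =>
          by_cases hl : l.IsChain (· ≠ ·)
          · rcases l with _ | ⟨b', l⟩
            · simp at hc
            · rw [List.isChain_cons_cons] at hc
              have : b = b' := by by_contra h; exact hc ⟨h, hl⟩
              exact ⟨[], l, b, by rw [this]; rfl⟩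
          · obtain ⟨l₁, l₂, b', rfl⟩ := ihl hl
            exact ⟨b :: l₁, l₂, b', rfl⟩
      obtain ⟨l₁, l₂, b, rfl⟩ := this
      have hr : (l₁ ++ b :: b :: l₂) ~r (b :: b :: (l₂ ++ l₁)) := List.isRotated_append
      have hlen : (l₂ ++ l₁).length + 2 = n := by
        rw [← hl, List.length_append, List.length_append, List.length_cons, List.length_cons]
        omega
      obtain ⟨w, hw, hwl⟩ := ih _ (by omega) (l₂ ++ l₁) rfl (by
        rw [← hlen] at hn
        simpa [Nat.even_add] using hn)
      refine ⟨w, .head ?_ hw, ?_⟩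
      · rw [Cycle.coe_eq_coe.mpr hr]
        exact .cancel b _
      · rw [hwl, ← natAbs_altSum_eq_of_isRotated hr (by rw [hl]; exact hn)]
        simp [altSum]

/-! ### Smoothings, and the arrow numbers of the loops of a state -/

/-- What happens at a crossing in a state: a virtual crossing stays, a classical crossing is
smoothed along the orientation or replaced by a c-pair. -/
inductive Smoothing
  | virtual
  | oriented
  | cusped
  deriving DecidableEq

instance : Fintype Smoothing where
  elems := {.virtual, .oriented, .cusped}
  complete := by rintro (_ | _ | _) <;> simp

namespace Smoothing

/-- The end that is joined to the end `(s, o)` of the crossing. -/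
def join : Smoothing → Bool → Bool → Bool × Bool
  | virtual, s, o => (!s, !o)
  | oriented, s, o => (s, !o)
  | cusped, s, o => (!s, o)

/-- The signed cusp at the end `(s, o)`: `1` if it points to the left of a tour that arrives there
and follows the orientation of the diagram, or to the right of a tour against the orientation. -/
def turn : Smoothing → Bool → ℤ
  | virtual, _ => 0
  | oriented, _ => 0
  | cusped, s => if s then 1 else -1

end Smoothing

namespace DiagramCode

variable (D : DiagramCode)

/-- How the ends are joined at the vertices, for a choice of smoothings. -/
def joinDart (k : D.X → Smoothing) : D.Dart → D.Dart
  | (Sum.inl (x, s), o) => (Sum.inl (x, ((k x).join s o).1), ((k x).join s o).2)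
  | (Sum.inr m, o) => (Sum.inr m, !o)

/-- The signed cusp at a dart. -/
def dartTurn (k : D.X → Smoothing) : D.Dart → ℤ
  | (Sum.inl (x, s), _) => (k x).turn s
  | (Sum.inr _, _) => 0

theorem joinDart_joinDart (k : D.X → Smoothing) (h : D.Dart) :
    D.joinDart k (D.joinDart k h) = h := by
  rcases h with ⟨⟨x, s⟩ | m, o⟩
  · simp only [joinDart]
    cases k x <;> simp [Smoothing.join]
  · simp [joinDart]

/-- `joinDart` as a permutation. -/
def joinPerm (k : D.X → Smoothing) : Equiv.Perm D.Dart :=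
  Function.Involutive.toPerm (D.joinDart k) (D.joinDart_joinDart k)

theorem joinPerm_apply (k : D.X → Smoothing) (h : D.Dart) : D.joinPerm k h = D.joinDart k h := rfl

theorem isJoining (k : D.X → Smoothing) : MapOrbit.IsJoining D.edgeFlip (D.joinPerm k) where
  left := D.edgeFlip_edgeFlip
  right := D.joinDart_joinDart k
  left_ne := by rintro ⟨p, _ | _⟩ h <;> simpa using congrArg Prod.snd h
  right_ne := by
    rintro ⟨⟨x, s⟩ | m, o⟩ h
    · simp only [joinPerm_apply, joinDart, Prod.mk.injEq, Sum.inl.injEq, true_and] at h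
      generalize k x = K at h
      cases K <;> simp [Smoothing.join] at h
    · simp [joinPerm_apply, joinDart] at h

theorem dartTurn_joinPerm (k : D.X → Smoothing) (h : D.Dart) :
    D.dartTurn k (D.joinPerm k h) = -D.dartTurn k h := by
  rcases h with ⟨⟨x, s⟩ | m, o⟩
  · simp only [joinPerm_apply, joinDart, dartTurn]
    cases k x <;> cases s <;> simp [Smoothing.join, Smoothing.turn]
  · simp [joinPerm_apply, joinDart, dartTurn]

/-- One step of a tour. -/
abbrev tour (k : D.X → Smoothing) : Equiv.Perm D.Dart := D.edgeFlip * D.joinPerm k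

namespace State

variable {D : DiagramCode}

/-- The smoothings of a state. -/
def smoothing (S : D.State) (x : D.X) : Smoothing :=
  if D.sgn x = 0 then .virtual else if S.IsCPair x then .cusped else .oriented

theorem pass_eq (S : D.State) : S.pass = D.joinPerm S.smoothing := by
  ext1 h
  rcases h with ⟨⟨x, s⟩ | m, o⟩
  · simp only [joinPerm_apply, joinDart, pass_apply, passFun, smoothing]
    split_ifs <;> rfl
  · rfl

theorem travel_eq (S : D.State) : S.travel = D.tour S.smoothing := by
  rw [travel, pass_eq]

theorem smoothing_eq_cusped {S : D.State} {x : D.X} : S.smoothing x = .cusped ↔ S.IsCPair x := by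
  unfold smoothing
  by_cases hx : D.sgn x = 0
  · have hx' : ¬S.IsCPair x := fun h => h.sgn_ne_zero hx
    simp [hx, hx']
  · by_cases hx' : S.IsCPair x <;> simp [hx, hx']

theorem dartTurn_inl (S : D.State) (x : D.X) (s o : Bool) :
    D.dartTurn S.smoothing (Sum.inl (x, s), o) =
      if S.IsCPair x then (if s then 1 else -1) else 0 := by
  have := smoothing_eq_cusped (S := S) (x := x)
  simp only [dartTurn, ← this]
  cases S.smoothing x <;> simp [Smoothing.turn]

/-- At a cusp a tour changes between following the orientation and running against it. -/
theorem travel_of_cusp (S : D.State) (h : D.Dart) :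
    (S.cusp h = none ∧ D.dartTurn S.smoothing h = 0 ∧ (S.travel h).2 = h.2) ∨
    ∃ b, S.cusp h = some b ∧ D.dartTurn S.smoothing h =
      (if h.2 then -1 else 1) * (if b then 1 else -1) ∧ (S.travel h).2 = !h.2 := by
  have hflip : ∀ h : D.Dart, (D.edgeFlip h).2 = !h.2 := by rintro ⟨p, _ | _⟩ <;> rfl
  simp only [travel, Equiv.Perm.mul_apply, hflip]
  rcases h with ⟨⟨x, s⟩ | m, o⟩
  · rw [dartTurn_inl]
    by_cases hx' : S.IsCPair x
    · right
      refine ⟨xor s o, by simp [cusp, hx'], ?_, by simp [pass_cPair hx']⟩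
      cases s <;> cases o <;> simp [hx']
    · left
      refine ⟨by simp [cusp, hx'], by simp [hx'], ?_⟩
      by_cases hx : D.sgn x = 0
      · simp [pass_virtual S hx]
      · simp [pass_oriented hx hx']
  · left
    simp [cusp, dartTurn]

/-- The alternating sum of the sides of the cusps along a tour is a sum of local contributions. -/
theorem altSum_tour (S : D.State) (n : ℕ) : ∀ h : D.Dart,
    altSum ((List.range n).filterMap fun i => S.cusp (S.travel^[i] h)) =
      (if h.2 then -1 else 1) * ∑ i ∈ Finset.range n, D.dartTurn S.smoothing (S.travel^[i] h) ∧
    (Even ((List.range n).filterMap fun i => S.cusp (S.travel^[i] h)).length ↔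
      (S.travel^[n] h).2 = h.2) := by
  induction n with
  | zero => intro h; simp [altSum]
  | succ n ih =>
    intro h
    rw [List.range_succ_eq_map, List.filterMap_cons, List.filterMap_map, Finset.sum_range_succ']
    obtain ⟨ih1, ih2⟩ := ih (S.travel h)
    simp only [Function.comp_def, Nat.succ_eq_add_one, Function.iterate_succ_apply,
      Function.iterate_zero_apply]
    rcases S.travel_of_cusp h with ⟨h1, h2, h3⟩ | ⟨b, h1, h2, h3⟩
    · rw [h1, h2, add_zero, ih1, ih2, h3]
      exact ⟨rfl, Iff.rfl⟩
    · rw [h1, h2]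
      simp only [altSum, List.length_cons]
      rw [ih1, h3, Nat.even_add_one, ih2, h3]
      constructor
      · cases h.2 <;> cases b <;> simp <;> ring
      · cases h.2 <;> cases (S.travel^[n] (S.travel h)).2 <;> simp

theorem sum_minimalPeriod {P : Type} [Fintype P] (t : Equiv.Perm P) (κ : P → ℤ) (p : P) :
    ∑ i ∈ Finset.range (Function.minimalPeriod t p), κ (t^[i] p) =
      MapOrbit.weight κ (Quot.mk _ p : MapOrbit t) := by
  classical
  unfold MapOrbit.weight
  rw [← Finset.sum_filter]
  have hinj : Set.InjOn (fun i => t^[i] p)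
      (Finset.range (Function.minimalPeriod t p) : Set ℕ) := by
    rw [Finset.coe_range]
    exact Function.iterate_injOn_Iio_minimalPeriod
  rw [← Finset.sum_image (f := κ) hinj]
  refine Finset.sum_congr ?_ fun _ _ => rfl
  ext q
  simp only [Finset.mem_image, Finset.mem_range, Finset.mem_filter, Finset.mem_univ, true_and]
  constructor
  · rintro ⟨i, -, rfl⟩
    exact MapOrbit.mk_iterate _ p i
  · intro h
    obtain ⟨n, -, hn⟩ := (MapOrbit.mk_eq_mk_iff.mp h.symm).exists_pow_eq'
    have hpos : 0 < Function.minimalPeriod t p :=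
      Function.minimalPeriod_pos_of_mem_periodicPts
        (Function.Injective.mem_periodicPts t.injective p)
    refine ⟨n % Function.minimalPeriod t p, Nat.mod_lt _ hpos, ?_⟩
    rw [Function.iterate_mod_minimalPeriod_eq, ← hn, Equiv.Perm.coe_pow]

/-- The weight of the orbit of a dart. -/
noncomputable def tourWeight (S : D.State) (h : D.Dart) : ℤ :=
  MapOrbit.weight (D.dartTurn S.smoothing) (Quot.mk _ h : MapOrbit (D.tour S.smoothing))

theorem natAbs_altSum_word (S : D.State) (h : D.Dart) :
    (altSum (S.word h)).natAbs = (S.tourWeight h).natAbs ∧ Even (S.word h).length := by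
  obtain ⟨h1, h2⟩ := S.altSum_tour (Function.minimalPeriod S.travel h) h
  unfold word
  rw [h2, h1, sum_minimalPeriod, Function.iterate_minimalPeriod, tourWeight, ← travel_eq]
  refine ⟨?_, rfl⟩
  split_ifs <;> simp

theorem loop_mk_eq_iff (S : D.State) {h h' : D.Dart}
    (heq : (Quotient.mk _ h : S.Loop) = Quotient.mk _ h') :
    (S.tourWeight h).natAbs = (S.tourWeight h').natAbs := by
  have H := D.isJoining S.smoothing
  rw [pass_eq] at heq
  unfold tourWeight
  rcases H.mk_eq_or heq with h1 | h1
  · rw [h1]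
  · rw [h1, H.weight_reverse (D.dartTurn_joinPerm _), Int.natAbs_neg]

theorem reducedCusps_mk (S : D.State) (h : D.Dart) :
    S.reducedCusps (Quotient.mk _ h) = (S.tourWeight h).natAbs := by
  have hlower : ∀ n ∈ {n | ∃ (h' : D.Dart) (w : Cycle Bool),
      (Quotient.mk _ h' : S.Loop) = Quotient.mk _ h ∧
      Relation.ReflTransGen CuspCancel (S.word h' : Cycle Bool) w ∧ w.length = n},
      (S.tourWeight h).natAbs ≤ n := by
    rintro n ⟨h', w, hh, hw, rfl⟩
    obtain ⟨h1, h2⟩ := S.natAbs_altSum_word h'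
    obtain ⟨l, rfl, -, h3⟩ := natAbs_altSum_of_cancel h2 hw
    rw [← S.loop_mk_eq_iff hh, ← h1, ← h3]
    exact natAbs_altSum_le l
  obtain ⟨h1, h2⟩ := S.natAbs_altSum_word h
  obtain ⟨w, hw, hwl⟩ := exists_reduced _ (S.word h) rfl h2
  refine le_antisymm (Nat.sInf_le ⟨h, w, rfl, hw, hwl.trans h1⟩) ?_
  exact hlower _ (Nat.sInf_mem ⟨_, h, w, rfl, hw, rfl⟩)

theorem even_tourWeight (S : D.State) (h : D.Dart) : Even (S.tourWeight h) := by
  obtain ⟨h1, h2⟩ := S.natAbs_altSum_word h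
  rw [← Int.natAbs_even, ← h1, Int.natAbs_even]
  exact even_altSum _ h2

theorem two_mul_loopArrowNumber (S : D.State) (h : D.Dart) :
    2 * S.loopArrowNumber (Quotient.mk _ h) = (S.tourWeight h).natAbs := by
  rw [loopArrowNumber, reducedCusps_mk]
  exact Nat.two_mul_div_two_of_even (Int.natAbs_even.mpr (S.even_tourWeight h))

/-! ### The sum of the signs of the c-pairs -/

theorem flip_snd (h : D.Dart) : (D.edgeFlip h).2 = !h.2 := by rcases h with ⟨p, _ | _⟩ <;> rfl

theorem dartLabel_edgeFlip (L : D.End → Bool) (h : D.Dart) :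
    D.dartLabel L (D.edgeFlip h) = D.dartLabel L h := by
  rcases h with ⟨p, _ | _⟩ <;> simp [dartLabel, inLabel]

/-- A choice of a direction on every loop of a state, as a function on the darts, is the same as a
labeling: an edge is labeled `0` if the chosen direction is opposite to its orientation. -/
def directionOfLabel (L : D.End → Bool) (h : D.Dart) : Bool := xor (D.dartLabel L h) h.2

theorem IsLabeling.directionOfLabel_pass {S : D.State} {L : D.End → Bool} (hL : S.IsLabeling L)
    (h : D.Dart) : directionOfLabel L (S.pass h) = !directionOfLabel L h := by
  have h1 := hL h
  have h2 := S.travel_of_cusp h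
  rw [travel, Equiv.Perm.mul_apply, flip_snd] at h2
  unfold directionOfLabel
  rcases h2 with ⟨h3, -, h4⟩ | ⟨b, h3, -, h4⟩
  · rw [h3] at h1
    have : D.dartLabel L (S.pass h) = D.dartLabel L h := by simpa using h1
    rw [this, ← h4]
    cases D.dartLabel L h <;> cases (S.pass h).2 <;> rfl
  · rw [h3] at h1
    have : D.dartLabel L (S.pass h) = !D.dartLabel L h := Bool.eq_not.mpr (by simpa using h1)
    rw [this, Bool.not_inj h4]
    cases D.dartLabel L h <;> cases h.2 <;> rfl

theorem directionOfLabel_edgeFlip (L : D.End → Bool) (h : D.Dart) :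
    directionOfLabel L (D.edgeFlip h) = !directionOfLabel L h := by
  unfold directionOfLabel
  rw [dartLabel_edgeFlip, flip_snd]
  cases D.dartLabel L h <;> cases h.2 <;> rfl

theorem exists_labeling (S : D.State) (c : MapOrbit (D.tour S.smoothing) → Bool)
    (hc : ∀ O, c ((D.isJoining S.smoothing).reverse O) = !c O) :
    ∃ L, S.IsLabeling L ∧ ∀ h, directionOfLabel L h = c (Quot.mk _ h) := by
  have H := D.isJoining S.smoothing
  have hflip : ∀ h : D.Dart, c (Quot.mk _ (D.edgeFlip h)) = !c (Quot.mk _ h) :=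
    fun h => hc (Quot.mk _ h)
  have hpass : ∀ h : D.Dart, c (Quot.mk _ (S.pass h)) = !c (Quot.mk _ h) := fun h => by
    rw [pass_eq, ← hc, H.reverse_mk_right]
  let L : D.End → Bool := fun p => !c (Quot.mk _ (p, true))
  have hL : ∀ h : D.Dart, D.dartLabel L h = xor (c (Quot.mk _ h)) h.2 := by
    rintro ⟨p, _ | _⟩
    · rw [← dartLabel_edgeFlip]
      simp only [edgeFlip_false, dartLabel, L, ← hflip, edgeFlip_true, Equiv.apply_symm_apply]
      simp
    · simp [dartLabel, L]
  refine ⟨L, fun h => ?_, fun h => ?_⟩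
  · rw [hL, hL, hpass]
    have h2 := S.travel_of_cusp h
    rw [travel, Equiv.Perm.mul_apply, flip_snd] at h2
    rcases h2 with ⟨h3, -, h4⟩ | ⟨b, h3, -, h4⟩
    · rw [h3, ← h4]
      cases c (Quot.mk _ h) <;> cases (S.pass h).2 <;> simp
    · rw [h3, Bool.not_inj h4]
      cases c (Quot.mk _ h) <;> cases h.2 <;> simp
  · unfold directionOfLabel
    rw [hL]
    cases c (Quot.mk _ h) <;> cases h.2 <;> rfl

/-- The sign of a c-pair is the mean of the contributions of its two cusps. -/
theorem IsLabeling.four_mul_cPairSum {S : D.State} {L : D.End → Bool} (hL : S.IsLabeling L) :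
    4 * S.cPairSum L =
      ∑ h, (if directionOfLabel L h then -1 else 1) * D.dartTurn S.smoothing h := by
  rw [Fintype.sum_prod_type, Fintype.sum_sum_type, Fintype.sum_prod_type, cPairSum, Finset.mul_sum]
  have hm : ∑ m : D.M, ∑ o, (if directionOfLabel L (Sum.inr m, o) then (-1 : ℤ) else 1) *
      D.dartTurn S.smoothing (Sum.inr m, o) = 0 := by simp [dartTurn]
  rw [hm, add_zero]
  refine Finset.sum_congr rfl fun x _ => ?_
  simp only [Fintype.sum_bool, dartTurn_inl, directionOfLabel, dartLabel]
  by_cases hx : S.IsCPair x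
  · have h1 := hL.cPair_in hx
    have h2 := hL.cPair_out hx
    rw [if_pos hx]
    by_cases hk : S.Keeps L x
    · have h3 := hL.keeps_label hk true
      rw [cPairSign_kept hk, lambda_sgn_kept hk, if_neg hx.sgn_ne_zero]
      rcases Bool.eq_false_or_eq_true (D.inLabel L (Sum.inl (x, false))) with h4 | h4 <;>
        rcases Bool.eq_false_or_eq_true (L (Sum.inl (x, false))) with h5 | h5 <;> simp_all
    · have h3 : D.inLabel L (Sum.inl (x, true)) ≠ L (Sum.inl (x, false)) := fun h =>
          hk (Or.inr ⟨hx, h⟩)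
      rw [cPairSign_not_kept hk]
      rcases Bool.eq_false_or_eq_true (D.inLabel L (Sum.inl (x, false))) with h4 | h4 <;>
        rcases Bool.eq_false_or_eq_true (L (Sum.inl (x, false))) with h5 | h5 <;> simp_all
  · simp [hx]

theorem IsLabeling.four_mul_cPairSum_eq {S : D.State} {L : D.End → Bool} (hL : S.IsLabeling L)
    [Fintype (MapOrbit (D.tour S.smoothing))] {c : MapOrbit (D.tour S.smoothing) → Bool}
    (hc : ∀ h, directionOfLabel L h = c (Quot.mk _ h)) :
    4 * S.cPairSum L = ∑ O : MapOrbit (D.tour S.smoothing),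
      (if c O then -1 else 1) * MapOrbit.weight (D.dartTurn S.smoothing) O := by
  rw [hL.four_mul_cPairSum, ← MapOrbit.weight_sum_eq]
  simp only [hc]

theorem IsLabeling.exists_direction {S : D.State} {L : D.End → Bool} (hL : S.IsLabeling L) :
    ∃ c : MapOrbit (D.tour S.smoothing) → Bool, ∀ h, directionOfLabel L h = c (Quot.mk _ h) := by
  refine ⟨Quot.lift (directionOfLabel L) ?_, fun h => rfl⟩
  intro p q hpq
  rw [← hpq, Equiv.Perm.mul_apply, directionOfLabel_edgeFlip, ← pass_eq,
    hL.directionOfLabel_pass, Bool.not_not]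

theorem four_mul_arrowNumber (S : D.State) [Fintype (MapOrbit (D.tour S.smoothing))] :
    4 * S.arrowNumber = ∑ O : MapOrbit (D.tour S.smoothing),
      (MapOrbit.weight (D.dartTurn S.smoothing) O).natAbs := by
  have H := D.isJoining S.smoothing
  have := Fintype.ofFinite (OrbitSet {D.edgeFlip, D.joinPerm S.smoothing})
  have key : ∀ (p : Equiv.Perm D.Dart) (hp : S.pass = p)
      [Fintype (OrbitSet {D.edgeFlip, p})] , ∃ m : OrbitSet {D.edgeFlip, p} → ℕ,
      (∀ h, m (Quotient.mk _ h) = S.loopArrowNumber (Quotient.mk _ h)) ∧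
        S.arrowNumber = ∑ C, m C := by
    rintro p rfl _
    exact ⟨S.loopArrowNumber, fun h => rfl, finsum_eq_sum_of_fintype _⟩
  obtain ⟨m, hm, hS⟩ := key _ S.pass_eq
  have hs := H.sum_loop m
  rw [nsmul_eq_mul, ← hS] at hs
  rw [show 4 * S.arrowNumber = 2 * (2 * S.arrowNumber) by ring]
  rw [show 2 * S.arrowNumber = _ from hs.symm, Finset.mul_sum]
  refine Finset.sum_congr rfl fun O _ => ?_
  induction O using Quot.inductionOn with
  | h p =>
    change 2 * m (Quotient.mk _ p) = _
    rw [hm, two_mul_loopArrowNumber]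
    rfl

theorem IsLabeling.cPairSum_le {S : D.State} {L : D.End → Bool} (hL : S.IsLabeling L) :
    S.cPairSum L ≤ S.arrowNumber := by
  have := Fintype.ofFinite (MapOrbit (D.tour S.smoothing))
  obtain ⟨c, hc⟩ := hL.exists_direction
  have h1 := hL.four_mul_cPairSum_eq hc
  have h2 := S.four_mul_arrowNumber
  have h3 : (∑ O : MapOrbit (D.tour S.smoothing),
      (if c O then -1 else 1) * MapOrbit.weight (D.dartTurn S.smoothing) O) ≤
      ∑ O : MapOrbit (D.tour S.smoothing),
        ((MapOrbit.weight (D.dartTurn S.smoothing) O).natAbs : ℤ) :=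
    Finset.sum_le_sum fun O _ => by split_ifs <;> omega
  rw [← Nat.cast_sum, ← h2, ← h1] at h3
  push_cast at h3
  omega

/-- If every loop is directed such that its weight is not negative, then equality holds. -/
theorem exists_labeling_cPairSum_eq (S : D.State) :
    ∃ L, S.IsLabeling L ∧ S.cPairSum L = S.arrowNumber := by
  have := Fintype.ofFinite (MapOrbit (D.tour S.smoothing))
  have H := D.isJoining S.smoothing
  obtain ⟨c₀, hc₀⟩ := H.exists_direction
  let w : MapOrbit (D.tour S.smoothing) → ℤ := MapOrbit.weight (D.dartTurn S.smoothing)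
  have hw : ∀ O, w (H.reverse O) = -w O := H.weight_reverse (D.dartTurn_joinPerm _)
  let c : MapOrbit (D.tour S.smoothing) → Bool := fun O =>
    if w O = 0 then c₀ O else decide (w O < 0)
  obtain ⟨L, hL, hLc⟩ := S.exists_labeling c (fun O => by
      simp only [c, hw, hc₀]
      by_cases h : w O = 0
      · simp [h]
      · have h' : -w O ≠ 0 := by omega
        rw [if_neg h, if_neg h']
        by_cases h2 : w O < 0
        · rw [decide_eq_true h2, decide_eq_false (by omega)]; rfl
        · rw [decide_eq_false h2, decide_eq_true (by omega)]; rfl)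
  refine ⟨L, hL, ?_⟩
  have h1 := hL.four_mul_cPairSum_eq (c := c) hLc
  have h2 := S.four_mul_arrowNumber
  have h3 : (∑ O : MapOrbit (D.tour S.smoothing),
      (if c O then -1 else 1) * w O) =
      ∑ O : MapOrbit (D.tour S.smoothing), ((w O).natAbs : ℤ) := by
    refine Finset.sum_congr rfl fun O _ => ?_
    simp only [c]
    by_cases h : w O = 0
    · simp [h]
    · by_cases h2 : w O < 0
      · simp only [h, h2, decide_true, if_true, if_false]; omega
      · simp only [h, h2, decide_false, if_false]
        simp only [Bool.false_eq_true, if_false]; omega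
  rw [← Nat.cast_sum, ← h2, ← h1] at h3
  push_cast at h3
  omega

end State

end DiagramCode

/-! ### Tangles: how a choice of smoothings joins the boundary points -/

/-- The half edges of the edges given by a wiring: `(p, true)` is the start `p` of an edge, and
`(q, false)` is the target `q` of an edge. The two half edges of every edge are exchanged. -/
def wireFlip {A : Type} (w : A ≃ A) : A × Bool → A × Bool
  | (p, true) => (w p, false)
  | (q, false) => (w.symm q, true)

/-- Arcs that join the boundary points of a disk, with the sums of their signed cusps. The arc that
starts at the boundary point `b` ends at `(μ b).1`; the entry points are `(j, false)`, and the
exit points are `(j, true)`. -/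
abbrev Matching (n : ℕ) : Type := Fin n × Bool → (Fin n × Bool) × ℤ

/-- A wiring of a tangle of `n` strands with `m` crossings. -/
abbrev Wiring (n m : ℕ) : Type := (Fin m × Bool) ⊕ Fin n ≃ (Fin m × Bool) ⊕ Fin n

namespace Wiring

/-- The half edges inside the disk. -/
abbrev Dart (n m : ℕ) : Type := ((Fin m × Bool) ⊕ Fin n) × Bool

variable {n m : ℕ} (w : Wiring n m)

/-- One step of a tour inside the disk. A tour stops at the boundary. -/
def step (k : Fin m → Smoothing) : Dart n m → Dart n m
  | (Sum.inl (c, s), o) =>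
      wireFlip w (Sum.inl (c, ((k c).join s o).1), ((k c).join s o).2)
  | (Sum.inr j, o) => (Sum.inr j, o)

/-- The signed cusp at a half edge. -/
def turn (k : Fin m → Smoothing) : Dart n m → ℤ
  | (Sum.inl (c, s), _) => (k c).turn s
  | (Sum.inr _, _) => 0

/-- A half edge at the crossing `0` through which a closed loop inside the disk passes. In the
tangles of the Reidemeister moves such a loop passes every crossing once. -/
def IsBase (k : Fin m → Smoothing) : Dart n m → Prop
  | (Sum.inl (c, s), o) => c.val = 0 ∧ (step w k)^[m] (Sum.inl (c, s), o) = (Sum.inl (c, s), o)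
  | (Sum.inr _, _) => False

instance (k : Fin m → Smoothing) : DecidablePred (IsBase w k) := fun x =>
  match x with
  | (Sum.inl (_, _), _) => instDecidableAnd
  | (Sum.inr _, _) => instDecidableFalse

/-- The base points of the closed loops inside the disk. Every loop has one for each direction. -/
abbrev Base (k : Fin m → Smoothing) : Type := {x : Dart n m // IsBase w k x}

instance (k : Fin m → Smoothing) : DecidableEq (Base w k) := inferInstance

/-- The boundary point or the base point at which a tour arrives, if this needs less than the given
number of steps, and the sum of the signed cusps on the way. -/
def run (k : Fin m → Smoothing) : ℕ → Dart n m → Option ((Fin n × Bool ⊕ Base w k) × ℤ)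
  | 0, _ => none
  | _ + 1, (Sum.inr j, o) => some (Sum.inl (j, !o), 0)
  | f + 1, (Sum.inl c, o) =>
      if h : IsBase w k (Sum.inl c, o) then some (Sum.inr ⟨_, h⟩, 0)
      else (run k f (step w k (Sum.inl c, o))).map fun r =>
        (r.1, turn (n := n) k (Sum.inl c, o) + r.2)

/-- A bound for the number of steps of a tour inside the disk. -/
def fuel (m : ℕ) : ℕ := 2 * m + 2

/-- The result of the tour that enters the disk at a boundary point. -/
def runFrom (k : Fin m → Smoothing) (b : Fin n × Bool) :
    Option ((Fin n × Bool ⊕ Base w k) × ℤ) :=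
  run w k (fuel m) (wireFlip w (Sum.inr b.1, !b.2))

/-- The arcs of a state of a tangle. -/
def matching (k : Fin m → Smoothing) : Matching n := fun b =>
  match runFrom w k b with
  | some (Sum.inl b', i) => (b', i)
  | _ => (b, 0)

/-- Every tour inside the disk arrives at the boundary or at a base point, and it arrives at the
boundary if it starts there; the tour from a base point comes back to it and has no cusps after
cancellation; and the number of base points is even. -/
def Valid (k : Fin m → Smoothing) : Prop :=
  (∀ c s o, (run w k (fuel m) (Sum.inl (c, s), o)).isSome) ∧
  (∀ j o, (runFrom w k (j, o)).any fun r => r.1.isLeft) ∧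
  (∀ x : Base w k, run w k (fuel m) (step w k x.1) = some (Sum.inr x, -turn k x.1)) ∧
  Even (Fintype.card (Base w k))

/-- The number of closed loops inside the disk. -/
def loops (k : Fin m → Smoothing) : ℕ := Fintype.card (Base w k) / 2

end Wiring

/-! ### The state sum of a tangle as a formal sum -/

namespace Smoothing

/-- Virtual crossings stay, and classical crossings are smoothed. -/
def allowed : SignType → Smoothing → Bool
  | .zero, virtual => true
  | .zero, _ => false
  | _, virtual => false
  | _, _ => true

/-- The exponent of the coefficient of a smoothing at a crossing of sign `ε`. -/
def exponent (ε : SignType) : Smoothing → ℤ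
  | virtual => 0
  | oriented => ε
  | cusped => -ε

/-- All choices of smoothings at `m` crossings. -/
def choices : (m : ℕ) → List (Fin m → Smoothing)
  | 0 => [Fin.elim0]
  | m + 1 => [virtual, oriented, cusped].flatMap fun a => (choices m).map fun k => Fin.cons a k

end Smoothing

/-- The exponents and coefficients of `d ^ l`. -/
def loopPower : ℕ → List (ℤ × ℤ)
  | 0 => [(0, 1)]
  | l + 1 => (loopPower l).flatMap fun t => [(t.1 + 2, -t.2), (t.1 - 2, -t.2)]

/-- The values of a matching. -/
def Matching.values {n : ℕ} (μ : Matching n) : List ((Fin n × Bool) × ℤ) :=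
  (List.finRange n).flatMap fun j => [μ (j, false), μ (j, true)]

/-- A formal linear combination of matchings, with coefficients in `ℤ[A, A⁻¹]`: a list of
exponents of `A` and matchings, with integral coefficients. -/
abbrev FormalSum (n : ℕ) : Type := List ((ℤ × List ((Fin n × Bool) × ℤ)) × ℤ)

/-- The coefficient of a matching with a power of `A`. -/
def FormalSum.coeff {n : ℕ} (t : FormalSum n) (key : ℤ × List ((Fin n × Bool) × ℤ)) : ℤ :=
  (t.map fun r => if r.1 = key then r.2 else 0).sum

/-- Equality of formal linear combinations. -/
def FormalSum.Equal {n : ℕ} (t t' : FormalSum n) : Prop :=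
  ∀ r ∈ t ++ t', FormalSum.coeff t r.1 = FormalSum.coeff t' r.1

/-- Multiplication by `c A ^ e`. -/
def FormalSum.shift {n : ℕ} (e c : ℤ) (t : FormalSum n) : FormalSum n :=
  t.map fun r => ((e + r.1.1, r.1.2), c * r.2)

namespace Wiring

variable {n m : ℕ} (w : Wiring n m)

/-- The state sum of a tangle with the wiring `w`, for signs `ε` of its crossings. -/
def formalSum (ε : Fin m → SignType) : FormalSum n :=
  (Smoothing.choices m).flatMap fun k =>
    if ∀ i, Smoothing.allowed (ε i) (k i) then
      (loopPower (loops w k)).map fun r =>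
        ((((List.finRange m).map fun i => (k i).exponent (ε i)).sum + r.1,
          (matching w k).values), r.2)
    else []

/-- All states of a tangle with the wiring `w` are valid, for signs `ε` of its crossings. -/
def IsValid (ε : Fin m → SignType) : Prop :=
  ∀ k ∈ Smoothing.choices m, (∀ i, Smoothing.allowed (ε i) (k i)) → Valid w k

instance (k : Fin m → Smoothing) : Decidable (Valid w k) := by
  unfold Valid
  infer_instance

instance (ε : Fin m → SignType) : Decidable (IsValid w ε) := by
  unfold IsValid
  infer_instance

/-- The state sums of two tangles agree up to the unit `c A ^ e`. -/
def Skein {m' : ℕ} (w : Wiring n m) (w' : Wiring n m') (ε : Fin m → SignType)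
    (ε' : Fin m' → SignType) (e c : ℤ) : Prop :=
  IsValid w ε ∧ IsValid w' ε' ∧ (formalSum w ε).Equal ((formalSum w' ε').shift e c)

instance decidableSkein {m' : ℕ} (w : Wiring n m) (w' : Wiring n m') (ε : Fin m → SignType)
    (ε' : Fin m' → SignType) (e c : ℤ) : Decidable (Skein w w' ε ε' e c) := by
  unfold Skein FormalSum.Equal
  infer_instance

end Wiring

namespace Tangle

instance (δ : Fin 3 → Bool) (ε : Fin 3 → SignType) : Decidable (TriClassical δ ε) := by
  unfold TriClassical
  infer_instance

instance (ε : Fin 3 → SignType) : Decidable (TriVirtual ε) := by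
  unfold TriVirtual
  infer_instance

/-- The state sums of the two positions of three lines, with crossings of signs `ε`, agree. The
wiring of a triangle does not depend on the signs of its crossings; they are set to `0` in it. -/
def TriSkein (δ : Fin 3 → Bool) (ε : Fin 3 → SignType) : Prop :=
  Wiring.Skein (triangle δ 0 true).wiring (triangle δ 0 false).wiring ε ε 0 1

instance (δ : Fin 3 → Bool) (ε : Fin 3 → SignType) : Decidable (TriSkein δ ε) :=
  Wiring.decidableSkein _ _ _ _ _ _

end Tangle

/-! ### The state sums of the tangles of the Reidemeister moves -/

/-! The following equalities are finite checks: all choices of signs, of directions and of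
smoothings are run through. -/

namespace Tangle

set_option maxRecDepth 100000 in
/-- A classical kink contributes the factor `-A ^ (3 ε)`, a virtual kink the factor `1`. -/
theorem skein_kink : ∀ (ε : SignType) (s : Bool), Wiring.Skein
    (kink ε s).wiring (trivial 1).wiring (fun _ => ε) (fun _ => 0) (3 * ε)
    (if ε = 0 then 1 else -1) := by
  decide +kernel

set_option maxRecDepth 100000 in
theorem skein_bigonParallel : ∀ ε : SignType, Wiring.Skein
    (bigonParallel ε).wiring (trivial 2).wiring (bigonParallel ε).sgn (fun _ => 0) 0 1 := by
  decide +kernel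

set_option maxRecDepth 100000 in
theorem skein_bigonAntiparallel : ∀ (ε : SignType) (s : Bool), Wiring.Skein
    (bigonAntiparallel ε s).wiring (trivial 2).wiring (bigonAntiparallel ε s).sgn
    (fun _ => 0) 0 1 := by
  decide +kernel

set_option maxRecDepth 100000 in
theorem triSkein_of_triVirtual_vec : ∀ a b c : Bool, ∀ x y z : SignType,
    TriVirtual ![x, y, z] → TriSkein ![a, b, c] ![x, y, z] := by
  decide +kernel

set_option maxRecDepth 100000 in
theorem triSkein_of_triClassical_vec : ∀ a b c : Bool, ∀ x y z : SignType,
    TriClassical ![a, b, c] ![x, y, z] → TriSkein ![a, b, c] ![x, y, z] := by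
  decide +kernel

theorem eq_vec {α : Type} (f : Fin 3 → α) : f = ![f 0, f 1, f 2] := by
  ext i
  fin_cases i <;> rfl

theorem triSkein_of_triVirtual (δ : Fin 3 → Bool) {ε : Fin 3 → SignType} (h : TriVirtual ε) :
    TriSkein δ ε := by
  rw [eq_vec δ, eq_vec ε]
  rw [eq_vec ε] at h
  exact triSkein_of_triVirtual_vec _ _ _ _ _ _ h

theorem triSkein_of_triClassical {δ : Fin 3 → Bool} {ε : Fin 3 → SignType}
    (h : TriClassical δ ε) : TriSkein δ ε := by
  rw [eq_vec δ, eq_vec ε]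
  rw [eq_vec δ, eq_vec ε] at h
  exact triSkein_of_triClassical_vec _ _ _ _ _ _ h

end Tangle

/-! ### The arrow polynomial as a sum over choices of smoothings -/

/-- The coefficient of a smoothing at a crossing of sign `ε`. -/
noncomputable def Smoothing.coeff (ε : SignType) (a : Smoothing) : LaurentPolynomial ℤ :=
  if Smoothing.allowed ε a then LaurentPolynomial.T (Smoothing.exponent ε a) else 0

theorem arrowVar_zero : arrowVar 0 = 1 := by simp [arrowVar]

theorem LaurentPolynomial.prod_T {ι : Type} (s : Finset ι) (f : ι → ℤ) :
    ∏ i ∈ s, (LaurentPolynomial.T (f i) : LaurentPolynomial ℤ) =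
      LaurentPolynomial.T (∑ i ∈ s, f i) := by
  classical
  induction s using Finset.induction_on with
  | empty => simp
  | insert a s ha ih => rw [Finset.prod_insert ha, Finset.sum_insert ha, ih, T_add]

/-- The contribution `d ^ (|S| - 1) ∏ K_{a(C)}` of the loops of a state, as a function of the
weights of its tours. Every loop is counted twice, once for each direction, and the weight is twice
the arrow number. -/
noncomputable def stateValue (Ω : Multiset ℕ) : ArrowRing :=
  MvPolynomial.C (loopValue ^ (Multiset.card Ω / 2 - 1)) *
    ∏ᶠ w, arrowVar (w / 2) ^ (Ω.count w / 2)

theorem stateValue_two_nsmul {ι : Type} [Fintype ι] (f : ι → ℕ) :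
    stateValue (2 • (Finset.univ.val.map f)) =
      MvPolynomial.C (loopValue ^ (Fintype.card ι - 1)) * ∏ i, arrowVar (f i / 2) := by
  classical
  have h1 : Multiset.card (2 • (Finset.univ.val.map f)) / 2 = Fintype.card ι := by
    rw [Multiset.card_nsmul, Multiset.card_map, Nat.mul_div_cancel_left _ two_pos]
    rfl
  have h2 : ∀ w, (2 • (Finset.univ.val.map f)).count w / 2 =
      (Finset.univ.val.map f).count w := fun w => by
    rw [Multiset.count_nsmul, Nat.mul_div_cancel_left _ two_pos]
  rw [stateValue, h1]
  congr 1
  simp only [h2]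
  rw [finprod_eq_prod_of_mulSupport_subset (s := (Finset.univ.val.map f).toFinset) _ (by
    intro w hw
    rw [Finset.mem_coe, Multiset.mem_toFinset]
    by_contra h
    exact hw (by simp [Multiset.count_eq_zero_of_notMem h]))]
  rw [← Finset.prod_multiset_map_count, Multiset.map_map]
  rfl

/-- Two loops with arrow number zero, i.e. one loop in both directions, contribute a factor `d`. -/
theorem stateValue_add_zeros {Ω : Multiset ℕ} (hΩ : 2 ≤ Multiset.card Ω) (l : ℕ) :
    stateValue (Ω + Multiset.replicate (2 * l) 0) =
      MvPolynomial.C (loopValue ^ l) * stateValue Ω := by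
  have h1 : Multiset.card (Ω + Multiset.replicate (2 * l) 0) / 2 - 1 =
      l + (Multiset.card Ω / 2 - 1) := by
    rw [Multiset.card_add, Multiset.card_replicate]
    omega
  have h2 : ∀ w, arrowVar (w / 2) ^ ((Ω + Multiset.replicate (2 * l) 0).count w / 2) =
      arrowVar (w / 2) ^ (Ω.count w / 2) := by
    intro w
    rcases eq_or_ne w 0 with rfl | hw
    · simp [arrowVar_zero]
    · rw [Multiset.count_add, Multiset.count_replicate, if_neg hw.symm, add_zero]
  rw [stateValue, stateValue, h1, finprod_congr h2, pow_add, MvPolynomial.C_mul, mul_assoc]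

namespace DiagramCode

variable {D : DiagramCode}

theorem State.isCPair_iff (S : D.State) {x : D.X} (h : D.sgn x ≠ 0) :
    S.IsCPair x ↔ S ⟨x, h⟩ ≠ decide (D.sgn x = 1) :=
  ⟨fun ⟨_, h'⟩ => h', fun h' => ⟨h, h'⟩⟩

theorem State.smoothing_injective :
    Function.Injective (State.smoothing : D.State → D.X → Smoothing) := by
  intro S S' h
  ext1 ⟨x, hx⟩
  have h1 : S.IsCPair x ↔ S'.IsCPair x := by
    rw [← smoothing_eq_cusped, h, smoothing_eq_cusped]
  rw [S.isCPair_iff hx, S'.isCPair_iff hx] at h1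
  revert h1
  generalize S ⟨x, hx⟩ = a
  generalize S' ⟨x, hx⟩ = b
  generalize decide (D.sgn x = 1) = c
  revert a b c
  decide

theorem State.allowed_smoothing (S : D.State) (x : D.X) :
    Smoothing.allowed (D.sgn x) (S.smoothing x) = true := by
  unfold smoothing
  by_cases h : D.sgn x = 0
  · rw [if_pos h, h]; rfl
  · rw [if_neg h]
    split_ifs <;> (revert h; cases D.sgn x <;> decide)

theorem State.exists_smoothing_eq {k : D.X → Smoothing}
    (hk : ∀ x, Smoothing.allowed (D.sgn x) (k x) = true) : ∃ S : D.State, S.smoothing = k := by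
  refine ⟨fun x => xor (decide (k x.1 = .cusped)) (decide (D.sgn x.1 = 1)), ?_⟩
  ext1 x
  have h1 := hk x
  unfold smoothing
  by_cases h : D.sgn x = 0
  · rw [if_pos h]
    rw [h] at h1
    revert h1
    cases k x <;> decide
  · rw [if_neg h]
    have aux : ∀ ε a, Smoothing.allowed ε a = true → ε ≠ 0 →
        (xor (decide (a = .cusped)) (decide (ε = 1)) ≠ decide (ε = 1) ↔ a = .cusped) ∧
          (a ≠ .cusped → a = .oriented) := by decide
    obtain ⟨h2, h3⟩ := aux _ _ h1 h
    split_ifs with hc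
    · rw [State.isCPair_iff _ h] at hc
      exact (h2.mp hc).symm
    · rw [State.isCPair_iff _ h] at hc
      exact (h3 fun h4 => hc (h2.mpr h4)).symm

theorem State.prod_coeff (S : D.State) :
    ∏ x, Smoothing.coeff (D.sgn x) (S.smoothing x) = LaurentPolynomial.T S.exponent := by
  simp only [Smoothing.coeff, allowed_smoothing, if_true]
  rw [LaurentPolynomial.prod_T]
  congr 1
  symm
  refine Fintype.sum_of_injective Subtype.val Subtype.val_injective _ _ ?_ ?_
  · intro x hx
    have : D.sgn x = 0 := by
      by_contra h
      exact hx ⟨⟨x, h⟩, rfl⟩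
    simp [smoothing, this, Smoothing.exponent]
  · rintro ⟨x, hx⟩
    unfold smoothing
    rw [if_neg hx]
    simp only [S.isCPair_iff hx]
    generalize S ⟨x, hx⟩ = b
    revert hx b
    generalize D.sgn x = ε
    revert ε
    decide

theorem State.weights_tour (S : D.State) [Fintype S.Loop] :
    MapOrbit.weights (D.tour S.smoothing) (D.dartTurn S.smoothing) =
      2 • (Finset.univ.val.map S.reducedCusps) := by
  have key : ∀ (p : Equiv.Perm D.Dart) (hp : S.pass = p)
      [Fintype (OrbitSet {D.edgeFlip, p})], ∃ m : OrbitSet {D.edgeFlip, p} → ℕ,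
      (∀ h, m (Quotient.mk _ h) = S.reducedCusps (Quotient.mk _ h)) ∧
        Finset.univ.val.map m = Finset.univ.val.map S.reducedCusps := by
    rintro p rfl _
    exact ⟨S.reducedCusps, fun h => rfl, by congr!⟩
  have := Fintype.ofFinite (OrbitSet {D.edgeFlip, D.joinPerm S.smoothing})
  obtain ⟨m, hm, hS⟩ := key _ S.pass_eq
  rw [← hS]
  exact (D.isJoining S.smoothing).weights_eq_two_nsmul fun h => by
    rw [hm, S.reducedCusps_mk]; rfl

theorem arrowPolynomial_eq (D : DiagramCode) : D.arrowPolynomial =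
    ∑ k : D.X → Smoothing, MvPolynomial.C (∏ x, Smoothing.coeff (D.sgn x) (k x)) *
      stateValue (MapOrbit.weights (D.tour k) (D.dartTurn k)) := by
  classical
  refine Fintype.sum_of_injective State.smoothing State.smoothing_injective _ _ ?_ ?_
  · intro k hk
    have : ∃ x, ¬Smoothing.allowed (D.sgn x) (k x) = true := by
      by_contra h
      push Not at h
      exact hk (State.exists_smoothing_eq h)
    obtain ⟨x, hx⟩ := this
    rw [Finset.prod_eq_zero (Finset.mem_univ x) (by rw [Smoothing.coeff, if_neg hx]), map_zero,
      zero_mul]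
  · intro S
    have := Fintype.ofFinite S.Loop
    rw [S.weights_tour, stateValue_two_nsmul, S.prod_coeff, finprod_eq_prod_of_fintype,
      Nat.card_eq_fintype_card, map_mul, mul_assoc]
    rfl

end DiagramCode

/-! ### Tours in a diagram that is glued from two tangles -/

namespace OuterTangle

variable {n : ℕ} (C : OuterTangle n) (T : Tangle n)

/-- The half edges outside the disk. -/
abbrev Dart : Type := (((C.X × Bool) ⊕ C.M) ⊕ Fin n) × Bool

/-- How the half edges outside the disk are joined if the disk contains the arcs `μ`. -/
def joinDart (k : C.X → Smoothing) (μ : Matching n) : C.Dart → C.Dart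
  | (Sum.inl (Sum.inl (x, s)), o) =>
      (Sum.inl (Sum.inl (x, ((k x).join s o).1)), ((k x).join s o).2)
  | (Sum.inl (Sum.inr m), o) => (Sum.inl (Sum.inr m), !o)
  | (Sum.inr j, o) => (Sum.inr (μ (j, o)).1.1, (μ (j, o)).1.2)

/-- The signed cusps at a half edge outside the disk, or on the arc of `μ` that starts there. -/
def turn (k : C.X → Smoothing) (μ : Matching n) : C.Dart → ℤ
  | (Sum.inl (Sum.inl (x, s)), _) => (k x).turn s
  | (Sum.inl (Sum.inr _), _) => 0
  | (Sum.inr j, o) => (μ (j, o)).2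

/-- One step of a tour outside the disk. -/
def tour (k : C.X → Smoothing) (μ : Matching n) (h : C.Dart) : C.Dart :=
  wireFlip C.wiring (C.joinDart k μ h)

/-- The half edges outside the disk as half edges of the glued diagram. -/
def outer : C.Dart → (C.fill T).Dart
  | (p, true) => ((outSplit C.X C.M (Fin T.m) n).symm (Sum.inl p), true)
  | (q, false) => ((inSplit C.X C.M (Fin T.m) n).symm (Sum.inl q), false)

/-- The half edges inside the disk as half edges of the glued diagram. -/
def inner : Wiring.Dart n T.m → (C.fill T).Dart
  | (p, true) => ((outSplit C.X C.M (Fin T.m) n).symm (Sum.inr p), true)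
  | (q, false) => ((inSplit C.X C.M (Fin T.m) n).symm (Sum.inr q), false)

/-- Every half edge of the glued diagram lies outside or inside the disk. -/
def split : (C.fill T).Dart → C.Dart ⊕ Wiring.Dart n T.m
  | (p, true) => (outSplit C.X C.M (Fin T.m) n p).map (·, true) (·, true)
  | (q, false) => (inSplit C.X C.M (Fin T.m) n q).map (·, false) (·, false)

variable {T}

theorem split_outer (h : C.Dart) : C.split T (C.outer T h) = Sum.inl h := by
  rcases h with ⟨p, _ | _⟩ <;> simp [split, outer]

theorem split_inner (h : Wiring.Dart n T.m) : C.split T (C.inner T h) = Sum.inr h := by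
  rcases h with ⟨p, _ | _⟩ <;> simp [split, inner]

theorem eq_outer_or_inner (h : (C.fill T).Dart) :
    (∃ h', h = C.outer T h') ∨ ∃ h', h = C.inner T h' := by
  rcases h with ⟨p, _ | _⟩
  · obtain ⟨q, rfl⟩ := (inSplit C.X C.M (Fin T.m) n).symm.surjective p
    rcases q with q | q
    · exact Or.inl ⟨(q, false), rfl⟩
    · exact Or.inr ⟨(q, false), rfl⟩
  · obtain ⟨q, rfl⟩ := (outSplit C.X C.M (Fin T.m) n).symm.surjective p
    rcases q with q | q
    · exact Or.inl ⟨(q, true), rfl⟩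
    · exact Or.inr ⟨(q, true), rfl⟩

theorem next_outSplit (p : (((C.X × Bool) ⊕ C.M) ⊕ Fin n) ⊕ ((Fin T.m × Bool) ⊕ Fin n)) :
    (C.fill T).next ((outSplit C.X C.M (Fin T.m) n).symm p) =
      (inSplit C.X C.M (Fin T.m) n).symm (p.map C.wiring T.wiring) := by
  change (inSplit C.X C.M (Fin T.m) n).symm ((C.wiring.sumCongr T.wiring)
    (outSplit C.X C.M (Fin T.m) n ((outSplit C.X C.M (Fin T.m) n).symm p))) = _
  rw [Equiv.apply_symm_apply]
  rfl

theorem edgeFlip_outer (h : C.Dart) :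
    (C.fill T).edgeFlip (C.outer T h) = C.outer T (wireFlip C.wiring h) := by
  rcases h with ⟨p, _ | _⟩
  · refine congrArg (·, true)
      (((C.fill T).next.symm_apply_eq).mpr ((C.next_outSplit _).trans ?_).symm)
    exact congrArg (fun q => (inSplit C.X C.M (Fin T.m) n).symm (Sum.inl q))
      (C.wiring.apply_symm_apply p)
  · exact congrArg (·, false) (C.next_outSplit (Sum.inl p))

theorem edgeFlip_inner (h : Wiring.Dart n T.m) :
    (C.fill T).edgeFlip (C.inner T h) = C.inner T (wireFlip T.wiring h) := by
  rcases h with ⟨p, _ | _⟩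
  · refine congrArg (·, true)
      (((C.fill T).next.symm_apply_eq).mpr ((C.next_outSplit _).trans ?_).symm)
    exact congrArg (fun q => (inSplit C.X C.M (Fin T.m) n).symm (Sum.inr q))
      (T.wiring.apply_symm_apply p)
  · exact congrArg (·, false) (C.next_outSplit (Sum.inr p))

/-- Smoothings outside and inside the disk. -/
def smoothings (kC : C.X → Smoothing) (k : Fin T.m → Smoothing) : (C.fill T).X → Smoothing :=
  Sum.elim kC k

variable (kC : C.X → Smoothing) (k : Fin T.m → Smoothing)

theorem joinDart_outer_inl (μ : Matching n) (p : (C.X × Bool) ⊕ C.M) (o : Bool) :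
    (C.fill T).joinDart (C.smoothings kC k) (C.outer T (Sum.inl p, o)) =
      C.outer T (C.joinDart kC μ (Sum.inl p, o)) := by
  rcases p with ⟨x, s⟩ | m
  · simp only [joinDart]
    cases hk : kC x <;> cases o <;>
      simp [outer, DiagramCode.joinDart, outSplit, inSplit, Smoothing.join, smoothings, hk] <;> rfl
  · cases o <;> rfl

theorem joinDart_outer_inr (j : Fin n) (o : Bool) :
    (C.fill T).joinDart (C.smoothings kC k) (C.outer T (Sum.inr j, o)) =
      C.inner T (Sum.inr j, !o) := by
  cases o <;> rfl

theorem joinDart_inner_inl (c : Fin T.m) (s o : Bool) :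
    (C.fill T).joinDart (C.smoothings kC k) (C.inner T (Sum.inl (c, s), o)) =
      C.inner T (Sum.inl (c, ((k c).join s o).1), ((k c).join s o).2) := by
  cases hk : k c <;> cases o <;>
    simp [inner, DiagramCode.joinDart, outSplit, inSplit, Smoothing.join, smoothings, hk] <;> rfl

theorem joinDart_inner_inr (j : Fin n) (o : Bool) :
    (C.fill T).joinDart (C.smoothings kC k) (C.inner T (Sum.inr j, o)) =
      C.outer T (Sum.inr j, !o) := by
  cases o <;> rfl

theorem dartTurn_outer_inl (μ : Matching n) (p : (C.X × Bool) ⊕ C.M) (o : Bool) :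
    (C.fill T).dartTurn (C.smoothings kC k) (C.outer T (Sum.inl p, o)) =
      C.turn kC μ (Sum.inl p, o) := by
  rcases p with ⟨x, s⟩ | m <;> cases o <;> rfl

theorem dartTurn_outer_inr (j : Fin n) (o : Bool) :
    (C.fill T).dartTurn (C.smoothings kC k) (C.outer T (Sum.inr j, o)) = 0 := by
  cases o <;> rfl

theorem dartTurn_inner (h : Wiring.Dart n T.m) :
    (C.fill T).dartTurn (C.smoothings kC k) (C.inner T h) = Wiring.turn k h := by
  rcases h with ⟨⟨c, s⟩ | j, _ | _⟩ <;> rfl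

theorem tour_outer_inl (μ : Matching n) (p : (C.X × Bool) ⊕ C.M) (o : Bool) :
    (C.fill T).tour (C.smoothings kC k) (C.outer T (Sum.inl p, o)) =
      C.outer T (C.tour kC μ (Sum.inl p, o)) := by
  rw [Equiv.Perm.mul_apply, DiagramCode.joinPerm_apply, C.joinDart_outer_inl kC k μ,
    edgeFlip_outer, tour]

theorem tour_outer_inr (j : Fin n) (o : Bool) :
    (C.fill T).tour (C.smoothings kC k) (C.outer T (Sum.inr j, o)) =
      C.inner T (wireFlip T.wiring (Sum.inr j, !o)) := by
  rw [Equiv.Perm.mul_apply, DiagramCode.joinPerm_apply, joinDart_outer_inr, edgeFlip_inner]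

theorem tour_inner_inl (c : Fin T.m × Bool) (o : Bool) :
    (C.fill T).tour (C.smoothings kC k) (C.inner T (Sum.inl c, o)) =
      C.inner T (Wiring.step T.wiring k (Sum.inl c, o)) := by
  rw [Equiv.Perm.mul_apply, DiagramCode.joinPerm_apply, joinDart_inner_inl, edgeFlip_inner]
  rfl

theorem tour_inner_inr (j : Fin n) (o : Bool) :
    (C.fill T).tour (C.smoothings kC k) (C.inner T (Sum.inr j, o)) =
      C.outer T (wireFlip C.wiring (Sum.inr j, !o)) := by
  rw [Equiv.Perm.mul_apply, DiagramCode.joinPerm_apply, joinDart_inner_inr, edgeFlip_outer]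

end OuterTangle

namespace Wiring

variable {n m : ℕ} {w : Wiring n m} {k : Fin m → Smoothing}

theorem run_succ {f : ℕ} : ∀ {x : Dart n m} {r : (Fin n × Bool ⊕ Base w k) × ℤ},
    run w k f x = some r → run w k (f + 1) x = some r := by
  induction f with
  | zero => intro x r h; simp [run] at h
  | succ f ih =>
    rintro ⟨c | j, o⟩ r h
    · rw [run] at h ⊢
      split_ifs at h ⊢ with hb
      · exact h
      · rw [Option.map_eq_some_iff] at h ⊢
        obtain ⟨r', h1, h2⟩ := h
        exact ⟨r', ih h1, h2⟩
    · exact h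

theorem run_fuel_step {c : Fin m × Bool} {o : Bool} (hb : ¬IsBase w k (Sum.inl c, o))
    {r : (Fin n × Bool ⊕ Base w k) × ℤ} (h : run w k (fuel m) (Sum.inl c, o) = some r) :
    run w k (fuel m) (step w k (Sum.inl c, o)) =
      some (r.1, r.2 - turn (n := n) k (Sum.inl c, o)) := by
  rw [fuel, run, dif_neg hb, Option.map_eq_some_iff] at h
  obtain ⟨r', h1, rfl⟩ := h
  rw [fuel, run_succ h1]
  simp

theorem run_base (x : Base w k) : run w k (fuel m) x.1 = some (Sum.inr x, 0) := by
  obtain ⟨⟨c | j, o⟩, hx⟩ := x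
  · rw [fuel, run, dif_pos hx]
  · exact hx.elim

theorem run_boundary (j : Fin n) (o : Bool) :
    run w k (fuel m) (Sum.inr j, o) = some (Sum.inl (j, !o), 0) := rfl

/-- The tour that enters the disk at a boundary point leaves it at the other end of an arc. -/
theorem Valid.runFrom_eq (hT : Valid w k) (b : Fin n × Bool) :
    runFrom w k b = some (Sum.inl (matching w k b).1, (matching w k b).2) := by
  have h := hT.2.1 b.1 b.2
  unfold matching
  change (runFrom w k b).any _ = true at h
  rcases h' : runFrom w k b with _ | ⟨b' | x, w⟩
  · rw [h'] at h
    simp at h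
  · rfl
  · rw [h'] at h
    simp at h

theorem Valid.isSome_run (hT : Valid w k) (x : Dart n m) : (run w k (fuel m) x).isSome := by
  rcases x with ⟨⟨c, s⟩ | j, o⟩
  · exact hT.1 c s o
  · rfl

end Wiring

namespace OuterTangle

variable {n : ℕ} (C : OuterTangle n) {T : Tangle n} (kC : C.X → Smoothing)
  {k : Fin T.m → Smoothing}

theorem exists_iterate_tour_mem (f : ℕ) : ∀ x : Wiring.Dart n T.m,
    (Wiring.run T.wiring k f x).isSome →
      ∃ i, ((C.fill T).tour (C.smoothings kC k))^[i] (C.inner T x) ∈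
      Set.range (Sum.elim (C.outer T) fun x : Wiring.Base T.wiring k => C.inner T x.1) := by
  induction f with
  | zero => intro x h; simp [Wiring.run] at h
  | succ f ih =>
    rintro ⟨c | j, o⟩ h
    · by_cases hb : Wiring.IsBase T.wiring k (Sum.inl c, o)
      · exact ⟨0, Sum.inr ⟨_, hb⟩, rfl⟩
      · rw [Wiring.run, dif_neg hb, Option.isSome_map] at h
        obtain ⟨i, hi⟩ := ih _ h
        exact ⟨i + 1, by rwa [Function.iterate_succ_apply, tour_inner_inl]⟩
    · refine ⟨1, Sum.inl (wireFlip C.wiring (Sum.inr j, !o)), ?_⟩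
      rw [Function.iterate_one, tour_inner_inr]
      rfl

/-- The loops of a glued diagram are the loops that the arcs inside the disk form with the outside,
and the closed loops inside the disk. -/
theorem weights_fill (hT : Wiring.Valid T.wiring k) :
    MapOrbit.weights ((C.fill T).tour (C.smoothings kC k))
        ((C.fill T).dartTurn (C.smoothings kC k)) =
      MapOrbit.weights (C.tour kC (Wiring.matching T.wiring k))
        (C.turn kC (Wiring.matching T.wiring k)) +
        Multiset.replicate (2 * Wiring.loops T.wiring k) 0 := by
  have heven : 2 * Wiring.loops T.wiring k = Fintype.card (Wiring.Base T.wiring k) :=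
    Nat.two_mul_div_two_of_even hT.2.2.2
  rw [heven, ← MapOrbit.weights_sum_id]
  -- The end of the tour inside the disk that starts at `x`, and the weight of this tour.
  let res : Wiring.Dart n T.m → (Fin n × Bool ⊕ Wiring.Base T.wiring k) × ℤ := fun x =>
    (Wiring.run T.wiring k (Wiring.fuel T.m) x).get (hT.isSome_run x)
  have hres : ∀ {x r}, Wiring.run T.wiring k (Wiring.fuel T.m) x = some r → res x = r := fun h =>
    Option.get_of_eq_some _ h
  have hrun : ∀ x, Wiring.run T.wiring k (Wiring.fuel T.m) x = some (res x) := fun x =>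
    (Option.some_get _).symm
  -- The point at which the tour continues. The base points represent the closed loops in the disk.
  let after : Fin n × Bool ⊕ Wiring.Base T.wiring k → C.Dart ⊕ Wiring.Base T.wiring k :=
    Sum.map (fun b => wireFlip C.wiring (Sum.inr b.1, b.2)) id
  refine MapOrbit.weights_firstReturn _ _ _ _
    (Sum.elim (C.outer T) fun x : Wiring.Base T.wiring k => C.inner T x.1)
    (fun p => (C.split T p).elim Sum.inl fun x => after (res x).1)
    (fun p => (C.split T p).elim (fun _ => 0) fun x => (res x).2) ?_ ?_ ?_ ?_ ?_
  · rintro (h | x)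
    · simp [split_outer]
    · simp [split_inner, hres (Wiring.run_base x), after]
  · rintro (h | x)
    · simp [split_outer]
    · simp [split_inner, hres (Wiring.run_base x)]
  · intro p hp
    rcases C.eq_outer_or_inner p with ⟨h, rfl⟩ | ⟨h, rfl⟩
    · exact (hp ⟨Sum.inl h, rfl⟩).elim
    · rcases h with ⟨c | j, o⟩
      · have hb : ¬Wiring.IsBase T.wiring k (Sum.inl c, o) := fun hb => hp ⟨Sum.inr ⟨_, hb⟩, rfl⟩
        have h1 := hres (Wiring.run_fuel_step hb (hrun _))
        rw [tour_inner_inl, split_inner, split_inner, dartTurn_inner]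
        simp [h1]
      · rw [tour_inner_inr, split_inner, split_outer, dartTurn_inner]
        simp [hres (Wiring.run_boundary j o), after, Wiring.turn]
  · rintro (⟨p | j, o⟩ | x)
    · simp only [Sum.elim_inl]
      rw [C.tour_outer_inl kC k (Wiring.matching T.wiring k), split_outer,
        C.dartTurn_outer_inl kC k (Wiring.matching T.wiring k)]
      simp
    · have h1 := hres (hT.runFrom_eq (j, o))
      simp only [Sum.elim_inl]
      rw [tour_outer_inr, split_inner, dartTurn_outer_inr]
      simp [h1, after, tour, joinDart, turn]
    · have h1 := hres (hT.2.2.1 x)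
      have h2 : (C.fill T).tour (C.smoothings kC k) (C.inner T x.1) =
          C.inner T (Wiring.step T.wiring k x.1) := by
        obtain ⟨⟨c | j, o⟩, hx⟩ := x
        · exact C.tour_inner_inl kC k c o
        · exact hx.elim
      simp only [Sum.elim_inr]
      rw [h2, split_inner, dartTurn_inner]
      simp [h1, after]
  · intro p
    rcases C.eq_outer_or_inner p with ⟨h, rfl⟩ | ⟨h, rfl⟩
    · exact ⟨0, Sum.inl h, rfl⟩
    · exact C.exists_iterate_tour_mem kC _ h (hT.isSome_run h)

end OuterTangle

/-! ### The arrow polynomial of a glued diagram -/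

theorem List.sum_map_flatMap {α β R : Type} [AddMonoid R] (l : List α) (g : α → List β)
    (f : β → R) : ((l.flatMap g).map f).sum = (l.map fun a => ((g a).map f).sum).sum := by
  induction l with
  | nil => rfl
  | cons a l ih => simp [List.flatMap_cons, ih]

namespace Smoothing

theorem sum_eq {R : Type} [AddCommMonoid R] (f : Smoothing → R) :
    ∑ a, f a = f virtual + (f oriented + f cusped) := by
  change ∑ a ∈ {virtual, oriented, cusped}, f a = _
  rw [Finset.sum_insert (by decide), Finset.sum_insert (by decide), Finset.sum_singleton]

theorem mem_choices {m : ℕ} : ∀ k : Fin m → Smoothing, k ∈ choices m := by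
  induction m with
  | zero => intro k; exact List.mem_singleton.mpr (Subsingleton.elim _ _)
  | succ m ih =>
    intro k
    refine List.mem_flatMap.mpr ⟨k 0, ?_, List.mem_map.mpr ⟨Fin.tail k, ih _, Fin.cons_self_tail k⟩⟩
    generalize k 0 = a
    revert a
    decide

theorem sum_choices {R : Type} [AddCommMonoid R] {m : ℕ} : ∀ f : (Fin m → Smoothing) → R,
    ((choices m).map f).sum = ∑ k, f k := by
  induction m with
  | zero =>
    intro f
    rw [Fintype.sum_unique, choices, List.map_singleton, List.sum_singleton]
    exact congrArg f (Subsingleton.elim _ _)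
  | succ m ih =>
    intro f
    rw [choices, List.sum_map_flatMap, ← (Fin.consEquiv fun _ => Smoothing).sum_comp,
      Fintype.sum_prod_type, sum_eq]
    simp only [List.map_cons, List.map_nil, List.sum_cons, List.sum_nil, add_zero, List.map_map, ih]
    rfl

end Smoothing

theorem Matching.values_injective {n : ℕ} :
    Function.Injective (Matching.values : Matching n → List ((Fin n × Bool) × ℤ)) := by
  intro μ μ' h
  have key : ∀ l : List (Fin n), (l.flatMap fun j => [μ (j, false), μ (j, true)]) =
      (l.flatMap fun j => [μ' (j, false), μ' (j, true)]) →
      ∀ j ∈ l, μ (j, false) = μ' (j, false) ∧ μ (j, true) = μ' (j, true) := by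
    intro l
    induction l with
    | nil => simp
    | cons a l ih =>
      intro h j hj
      simp only [List.flatMap_cons, List.cons_append, List.nil_append, List.cons.injEq] at h
      rcases List.mem_cons.mp hj with rfl | hj
      · exact ⟨h.1, h.2.1⟩
      · exact ih h.2.2 j hj
  funext ⟨j, o⟩
  cases o
  · exact (key _ h j (List.mem_finRange j)).1
  · exact (key _ h j (List.mem_finRange j)).2

namespace FormalSum

variable {n : ℕ} (F : List ((Fin n × Bool) × ℤ) → ArrowRing)

/-- The value of a formal sum, for given values of the matchings. -/
noncomputable def eval (t : FormalSum n) : ArrowRing :=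
  (t.map fun r => r.2 • (MvPolynomial.C (LaurentPolynomial.T r.1.1) * F r.1.2)).sum

theorem eval_eq_sum_coeff (t : FormalSum n) (s : Finset (ℤ × List ((Fin n × Bool) × ℤ)))
    (hs : ∀ r ∈ t, r.1 ∈ s) : eval F t =
      ∑ key ∈ s, coeff t key • (MvPolynomial.C (LaurentPolynomial.T key.1) * F key.2) := by
  induction t with
  | nil => simp [eval, coeff]
  | cons r t ih =>
    have h1 := ih fun r' h => hs r' (List.mem_cons_of_mem _ h)
    have h2 : ∀ key, coeff (r :: t) key = (if r.1 = key then r.2 else 0) + coeff t key := fun _ =>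
      rfl
    simp only [h2, add_smul, Finset.sum_add_distrib, ← h1, ite_smul, zero_smul]
    rw [Finset.sum_ite_eq, if_pos (hs r List.mem_cons_self)]
    rfl

theorem Equal.eval_eq {t t' : FormalSum n} (h : t.Equal t') : eval F t = eval F t' := by
  let s := ((t ++ t').map Prod.fst).toFinset
  have hs : ∀ r ∈ t ++ t', r.1 ∈ s := fun r hr =>
    List.mem_toFinset.mpr (List.mem_map_of_mem hr)
  rw [eval_eq_sum_coeff F t s fun r hr => hs r (List.mem_append_left _ hr),
    eval_eq_sum_coeff F t' s fun r hr => hs r (List.mem_append_right _ hr)]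
  refine Finset.sum_congr rfl fun key hkey => ?_
  obtain ⟨r, hr, rfl⟩ := List.mem_map.mp (List.mem_toFinset.mp hkey)
  rw [h r hr]

theorem eval_shift (e c : ℤ) (t : FormalSum n) :
    eval F (t.shift e c) = MvPolynomial.C (c • LaurentPolynomial.T e) * eval F t := by
  induction t with
  | nil => simp [eval, shift]
  | cons r t ih =>
    have h1 : eval F (FormalSum.shift e c (r :: t)) = (c * r.2) •
        (MvPolynomial.C (LaurentPolynomial.T (e + r.1.1)) * F r.1.2) +
          eval F (FormalSum.shift e c t) := rfl
    have h2 : eval F (r :: t) =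
        r.2 • (MvPolynomial.C (LaurentPolynomial.T r.1.1) * F r.1.2) + eval F t := rfl
    rw [h1, h2, ih, LaurentPolynomial.T_add]
    simp only [zsmul_eq_mul, map_mul, map_intCast]
    push_cast
    ring

theorem eval_flatMap {α : Type} (l : List α) (g : α → FormalSum n) :
    eval F (l.flatMap g) = (l.map fun a => eval F (g a)).sum :=
  List.sum_map_flatMap _ _ _

theorem eval_loopPower (v : List ((Fin n × Bool) × ℤ)) (l : ℕ) : ∀ e : ℤ,
    eval F ((loopPower l).map fun r => ((e + r.1, v), r.2)) =
      MvPolynomial.C (LaurentPolynomial.T e * loopValue ^ l) * F v := by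
  induction l with
  | zero =>
    intro e
    simp [loopPower, eval]
  | succ l ih =>
    intro e
    have h1 : ∀ t : ℤ × ℤ, ((([(t.1 + 2, -t.2), (t.1 - 2, -t.2)] : List (ℤ × ℤ)).map fun r =>
        r.2 • (MvPolynomial.C (LaurentPolynomial.T (e + r.1)) * F v)).sum : ArrowRing) =
        MvPolynomial.C loopValue *
          (t.2 • (MvPolynomial.C (LaurentPolynomial.T (e + t.1)) * F v)) := by
      intro t
      simp only [List.map_cons, List.map_nil, List.sum_cons, List.sum_nil, add_zero, sub_eq_add_neg,
        ← add_assoc, LaurentPolynomial.T_add _ 2, LaurentPolynomial.T_add _ (-2), loopValue,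
        map_add, map_mul, map_neg, zsmul_eq_mul]
      push_cast
      ring
    have h2 := ih e
    simp only [eval, List.map_map, Function.comp_def] at h2 ⊢
    rw [loopPower, List.sum_map_flatMap]
    simp only [h1]
    rw [List.sum_map_mul_left, h2, pow_succ]
    simp only [map_mul]
    ring

end FormalSum

namespace Wiring

variable {n m : ℕ} (w : Wiring n m)

theorem eval_formalSum (ε : Fin m → SignType) (F : List ((Fin n × Bool) × ℤ) → ArrowRing) :
    FormalSum.eval F (w.formalSum ε) = ∑ k : Fin m → Smoothing,
      MvPolynomial.C ((∏ i, Smoothing.coeff (ε i) (k i)) * loopValue ^ w.loops k) *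
        F (w.matching k).values := by
  rw [formalSum, FormalSum.eval_flatMap, Smoothing.sum_choices]
  refine Finset.sum_congr rfl fun k _ => ?_
  split_ifs with h
  · rw [FormalSum.eval_loopPower]
    simp only [Smoothing.coeff, h, if_true]
    rw [LaurentPolynomial.prod_T, Fin.sum_univ_def]
  · push Not at h
    obtain ⟨i, hi⟩ := h
    rw [Finset.prod_eq_zero (Finset.mem_univ i) (by rw [Smoothing.coeff, if_neg hi]), zero_mul,
      map_zero, zero_mul]
    rfl

end Wiring

namespace OuterTangle

variable {n : ℕ} (C : OuterTangle n) {T : Tangle n}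

/-- The contribution of the loops that pass through the outside of the disk. -/
noncomputable def loopsValue (kC : C.X → Smoothing) (μ : Matching n) : ArrowRing :=
  stateValue (MapOrbit.weights (C.tour kC μ) (C.turn kC μ))

theorem stateValue_fill (hn : 0 < n) (kC : C.X → Smoothing) {k : Fin T.m → Smoothing}
    (hT : Wiring.Valid T.wiring k) :
    stateValue (MapOrbit.weights ((C.fill T).tour (C.smoothings kC k))
      ((C.fill T).dartTurn (C.smoothings kC k))) =
      MvPolynomial.C (loopValue ^ Wiring.loops T.wiring k) *
        C.loopsValue kC (Wiring.matching T.wiring k) := by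
  rw [weights_fill C kC hT, stateValue_add_zeros, loopsValue]
  have h1 := congrArg Multiset.card (weights_fill C kC hT)
  rw [Multiset.card_add, Multiset.card_replicate] at h1
  have h2 : Even (Multiset.card (MapOrbit.weights ((C.fill T).tour (C.smoothings kC k))
      ((C.fill T).dartTurn (C.smoothings kC k)))) := by
    rw [MapOrbit.card_weights]
    exact ((C.fill T).isJoining _).even_card
  have h3 : 0 < Multiset.card (MapOrbit.weights (C.tour kC (Wiring.matching T.wiring k))
      (C.turn kC (Wiring.matching T.wiring k))) := by
    rw [MapOrbit.card_weights]
    have : Nonempty (MapOrbit (C.tour kC (Wiring.matching T.wiring k))) :=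
      ⟨Quot.mk _ (Sum.inr ⟨0, hn⟩, true)⟩
    exact Nat.card_pos
  obtain ⟨a, ha⟩ := h2
  omega

theorem arrowPolynomial_fill (hn : 0 < n) (hT : Wiring.IsValid T.wiring T.sgn) :
    (C.fill T).arrowPolynomial = ∑ kC : C.X → Smoothing,
      MvPolynomial.C (∏ x, Smoothing.coeff (C.sgn x) (kC x)) *
        FormalSum.eval (Function.extend Matching.values (C.loopsValue kC) 0)
          (Wiring.formalSum T.wiring T.sgn) := by
  rw [DiagramCode.arrowPolynomial_eq]
  refine ((Equiv.sumArrowEquivProdArrow C.X (Fin T.m) Smoothing).symm.sum_comp _).symm.trans ?_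
  rw [Fintype.sum_prod_type]
  refine Finset.sum_congr rfl fun kC _ => ?_
  rw [Wiring.eval_formalSum, Finset.mul_sum]
  refine Finset.sum_congr rfl fun k _ => ?_
  rw [Matching.values_injective.extend_apply]
  have h1 : ∏ x : (C.fill T).X, Smoothing.coeff ((C.fill T).sgn x) (C.smoothings kC k x) =
      (∏ x, Smoothing.coeff (C.sgn x) (kC x)) * ∏ i, Smoothing.coeff (T.sgn i) (k i) :=
    Fintype.prod_sum_type _
  change MvPolynomial.C (∏ x : (C.fill T).X, Smoothing.coeff ((C.fill T).sgn x)
    (C.smoothings kC k x)) * stateValue (MapOrbit.weights ((C.fill T).tour (C.smoothings kC k))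
      ((C.fill T).dartTurn (C.smoothings kC k))) = _
  rw [h1]
  by_cases h : ∀ i, Smoothing.allowed (T.sgn i) (k i)
  · rw [C.stateValue_fill hn kC (hT k (Smoothing.mem_choices k) h)]
    simp only [map_mul]
    ring
  · push Not at h
    obtain ⟨i, hi⟩ := h
    rw [Finset.prod_eq_zero (Finset.mem_univ i) (by rw [Smoothing.coeff, if_neg hi])]
    simp

/-- If the state sums of two tangles agree up to a unit, then so do the arrow polynomials of the
diagrams in which one is replaced by the other. -/
theorem arrowPolynomial_fill_of_skein (hn : 0 < n) {T T' : Tangle n} {e c : ℤ}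
    (h : Wiring.Skein T.wiring T'.wiring T.sgn T'.sgn e c) :
    (C.fill T).arrowPolynomial =
      MvPolynomial.C (c • LaurentPolynomial.T e) * (C.fill T').arrowPolynomial := by
  rw [C.arrowPolynomial_fill hn h.1, C.arrowPolynomial_fill hn h.2.1, Finset.mul_sum]
  refine Finset.sum_congr rfl fun kC _ => ?_
  rw [h.2.2.eval_eq, FormalSum.eval_shift]
  ring

end OuterTangle

/-! ### Invariance of the maximum k-degree under the moves -/

namespace DiagramCode

variable {D D' : DiagramCode}

/-- The bijection between the half edges that an isomorphism induces. -/
def Iso.onDart (e : Iso D D') : D.Dart ≃ D'.Dart :=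
  ((e.onX.prodCongr (Equiv.refl Bool)).sumCongr e.onM).prodCongr (Equiv.refl Bool)

theorem Iso.edgeFlip_onDart (e : Iso D D') (h : D.Dart) :
    D'.edgeFlip (e.onDart h) = e.onDart (D.edgeFlip h) := by
  rcases h with ⟨p, _ | _⟩
  · refine congrArg (·, true) (D'.next.symm_apply_eq.mpr ?_)
    refine Eq.trans ?_ (e.next_eq (D.next.symm p)).symm
    rw [Equiv.apply_symm_apply]
  · exact congrArg (·, false) (e.next_eq p)

theorem Iso.joinDart_onDart (e : Iso D D') (k : D'.X → Smoothing) (h : D.Dart) :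
    D'.joinDart k (e.onDart h) = e.onDart (D.joinDart (k ∘ e.onX) h) := by
  rcases h with ⟨⟨x, s⟩ | m, o⟩ <;> rfl

theorem Iso.dartTurn_onDart (e : Iso D D') (k : D'.X → Smoothing) (h : D.Dart) :
    D'.dartTurn k (e.onDart h) = D.dartTurn (k ∘ e.onX) h := by
  rcases h with ⟨⟨x, s⟩ | m, o⟩ <;> rfl

theorem Iso.weights_eq (e : Iso D D') (k : D'.X → Smoothing) :
    MapOrbit.weights (D'.tour k) (D'.dartTurn k) =
      MapOrbit.weights (D.tour (k ∘ e.onX)) (D.dartTurn (k ∘ e.onX)) := by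
  have hι : ∀ p, p ∈ Set.range e.onDart := e.onDart.surjective
  refine MapOrbit.weights_firstReturn _ _ _ _ e.onDart e.onDart.symm (fun _ => 0)
    (fun q => e.onDart.symm_apply_apply q) (fun _ => rfl) (fun p hp => (hp (hι p)).elim)
    (fun q => ⟨?_, ?_⟩) (fun p => ⟨0, hι _⟩)
  · rw [Equiv.Perm.mul_apply, joinPerm_apply, e.joinDart_onDart, e.edgeFlip_onDart,
      Equiv.symm_apply_apply]
    rfl
  · rw [e.dartTurn_onDart, add_zero]

theorem Iso.arrowPolynomial_eq (e : Iso D D') : D'.arrowPolynomial = D.arrowPolynomial := by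
  rw [DiagramCode.arrowPolynomial_eq, DiagramCode.arrowPolynomial_eq]
  refine Fintype.sum_equiv (e.onX.symm.arrowCongr (Equiv.refl Smoothing)) _ _ fun k => ?_
  change _ = MvPolynomial.C (∏ x, Smoothing.coeff (D.sgn x) (k (e.onX x))) *
    stateValue (MapOrbit.weights (D.tour (k ∘ e.onX)) (D.dartTurn (k ∘ e.onX)))
  rw [e.weights_eq, ← e.onX.prod_comp]
  simp only [e.sgn_eq]

section Subdivide

variable (D) (e : D.End)

/-- The old ends in the subdivided diagram. -/
def oldEnd (p : D.End) : (D.subdivide e).End := (optionEnd D.X D.M).symm (some p)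

/-- The new marked point. -/
def newEnd : (D.subdivide e).End := Sum.inr none

theorem eq_oldEnd_or_newEnd (p : (D.subdivide e).End) :
    (∃ q, p = D.oldEnd e q) ∨ p = D.newEnd e := by
  rcases p with p | _ | m
  · exact Or.inl ⟨Sum.inl p, rfl⟩
  · exact Or.inr rfl
  · exact Or.inl ⟨Sum.inr m, rfl⟩

theorem subdivide_next_oldEnd {p : D.End} (hp : p ≠ e) :
    (D.subdivide e).next (D.oldEnd e p) = D.oldEnd e (D.next p) := by
  change (optionEnd D.X D.M).symm (Equiv.optionCongr D.next (Equiv.swap none (some e)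
    (optionEnd D.X D.M ((optionEnd D.X D.M).symm (some p))))) = _
  rw [Equiv.apply_symm_apply, Equiv.swap_apply_of_ne_of_ne (by simp) (by simpa using hp)]
  rfl

theorem subdivide_next_oldEnd_self : (D.subdivide e).next (D.oldEnd e e) = D.newEnd e := by
  change (optionEnd D.X D.M).symm (Equiv.optionCongr D.next (Equiv.swap none (some e)
    (optionEnd D.X D.M ((optionEnd D.X D.M).symm (some e))))) = _
  rw [Equiv.apply_symm_apply, Equiv.swap_apply_right]
  rfl

theorem subdivide_next_newEnd :
    (D.subdivide e).next (D.newEnd e) = D.oldEnd e (D.next e) := by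
  change (optionEnd D.X D.M).symm (Equiv.optionCongr D.next (Equiv.swap none (some e) none)) = _
  rw [Equiv.swap_apply_left]
  rfl

/-- The half edges of the subdivided diagram as half edges of the original diagram: the half edges
at the new marked point are moved past it, in the direction in which a tour passes it. -/
def collapse : (D.subdivide e).Dart → D.Dart := fun h =>
  (optionEnd D.X D.M h.1).elim (if h.2 then (e, true) else (D.next e, false)) (·, h.2)

theorem collapse_oldEnd (p : D.End) (o : Bool) : D.collapse e (D.oldEnd e p, o) = (p, o) := by
  change ((optionEnd D.X D.M) ((optionEnd D.X D.M).symm (some p))).elim _ _ = _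
  rw [Equiv.apply_symm_apply]
  rfl

theorem collapse_edgeFlip (p : D.End) (o : Bool) :
    D.collapse e ((D.subdivide e).edgeFlip (D.oldEnd e p, o)) = D.edgeFlip (p, o) := by
  cases o
  · rw [edgeFlip_false, edgeFlip_false]
    by_cases hp : p = D.next e
    · have : (D.subdivide e).next.symm (D.oldEnd e p) = D.newEnd e := by
        rw [Equiv.symm_apply_eq, subdivide_next_newEnd, hp]
      rw [this, hp, Equiv.symm_apply_apply]
      rfl
    · have : (D.subdivide e).next.symm (D.oldEnd e p) = D.oldEnd e (D.next.symm p) := by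
        rw [Equiv.symm_apply_eq, subdivide_next_oldEnd, Equiv.apply_symm_apply]
        rintro rfl
        exact hp (D.next.apply_symm_apply p).symm
      rw [this, collapse_oldEnd]
  · rw [edgeFlip_true, edgeFlip_true]
    by_cases hp : p = e
    · rw [hp, subdivide_next_oldEnd_self]
      rfl
    · rw [subdivide_next_oldEnd _ _ hp, collapse_oldEnd]

theorem weights_subdivide (k : D.X → Smoothing) :
    MapOrbit.weights ((D.subdivide e).tour k) ((D.subdivide e).dartTurn k) =
      MapOrbit.weights (D.tour k) (D.dartTurn k) := by
  let ι : D.Dart → (D.subdivide e).Dart := fun h => (D.oldEnd e h.1, h.2)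
  have hι : ∀ p o, (D.oldEnd e p, o) ∈ Set.range ι := fun p o => ⟨(p, o), rfl⟩
  -- A tour that arrives at the new marked point leaves it at an old end.
  have hnew : ∀ o, ∃ p, (D.subdivide e).tour k (D.newEnd e, o) = (D.oldEnd e p, o) ∧
      D.collapse e (D.newEnd e, o) = (p, o) := by
    rintro (_ | _)
    · exact ⟨D.next e, congrArg (·, false) (D.subdivide_next_newEnd e), rfl⟩
    · exact ⟨e, congrArg (·, true) ((Equiv.symm_apply_eq _).mpr
        (D.subdivide_next_oldEnd_self e).symm), rfl⟩
  have hjoin : ∀ h, (D.subdivide e).joinDart k (ι h) = ι (D.joinDart k h) := by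
    rintro ⟨⟨x, s⟩ | m, o⟩ <;> rfl
  have hturn : ∀ h, (D.subdivide e).dartTurn k (ι h) = D.dartTurn k h := by
    rintro ⟨⟨x, s⟩ | m, o⟩ <;> rfl
  refine MapOrbit.weights_firstReturn _ _ _ _ ι (D.collapse e) (fun _ => 0)
    (fun h => D.collapse_oldEnd e h.1 h.2) (fun _ => rfl) ?_ ?_ ?_
  · rintro ⟨p, o⟩ hp
    rcases D.eq_oldEnd_or_newEnd e p with ⟨q, rfl⟩ | rfl
    · exact (hp (hι q o)).elim
    · obtain ⟨q, h1, h2⟩ := hnew o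
      exact ⟨by rw [h1, h2, collapse_oldEnd], rfl⟩
  · intro h
    refine ⟨?_, by rw [hturn, add_zero]⟩
    change D.collapse e ((D.subdivide e).edgeFlip ((D.subdivide e).joinDart k (ι h))) = _
    rw [hjoin]
    exact D.collapse_edgeFlip e _ _
  · rintro ⟨p, o⟩
    rcases D.eq_oldEnd_or_newEnd e p with ⟨q, rfl⟩ | rfl
    · exact ⟨0, hι q o⟩
    · obtain ⟨q, h1, -⟩ := hnew o
      exact ⟨1, by rw [Function.iterate_one, h1]; exact hι q o⟩

theorem arrowPolynomial_subdivide : (D.subdivide e).arrowPolynomial = D.arrowPolynomial := by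
  rw [DiagramCode.arrowPolynomial_eq, DiagramCode.arrowPolynomial_eq]
  refine Finset.sum_congr rfl fun k _ => ?_
  exact congrArg (fun Ω => _ * stateValue Ω) (D.weights_subdivide e k)

end Subdivide

end DiagramCode

theorem maxKDegree_C_mul {u : LaurentPolynomial ℤ} (hu : IsUnit u) (p : ArrowRing) :
    maxKDegree (MvPolynomial.C u * p) = maxKDegree p := by
  have : (MvPolynomial.C u * p).support = p.support := by
    ext m
    rw [MvPolynomial.mem_support_iff, MvPolynomial.mem_support_iff, MvPolynomial.coeff_C_mul,
      not_iff_not]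
    exact hu.mul_right_eq_zero
  rw [maxKDegree, this, maxKDegree]

theorem maxKDegree_fill_of_skein {n : ℕ} (C : OuterTangle n) (hn : 0 < n) {T T' : Tangle n}
    {e c : ℤ} (hc : IsUnit c) (h : Wiring.Skein T.wiring T'.wiring T.sgn T'.sgn e c) :
    maxKDegree (C.fill T).arrowPolynomial = maxKDegree (C.fill T').arrowPolynomial := by
  rw [C.arrowPolynomial_fill_of_skein hn h, maxKDegree_C_mul]
  rw [zsmul_eq_mul]
  exact (hc.map (Int.castRingHom _)).mul (LaurentPolynomial.isUnit_T e)

/-- The first moves change the arrow polynomial by a unit, and the other moves do not change it. -/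
theorem DiagramCode.Step.maxKDegree_eq {D D' : DiagramCode} (h : DiagramCode.Step D D') :
    maxKDegree D.arrowPolynomial = maxKDegree D'.arrowPolynomial := by
  cases h with
  | iso e => rw [e.arrowPolynomial_eq]
  | subdivide e => rw [D.arrowPolynomial_subdivide]
  | one C ε s =>
    exact (maxKDegree_fill_of_skein C one_pos (by split_ifs <;> simp)
      (Tangle.skein_kink ε s)).symm
  | two_parallel C ε =>
    exact (maxKDegree_fill_of_skein C two_pos isUnit_one (Tangle.skein_bigonParallel ε)).symm
  | two_antiparallel C ε s =>
    exact (maxKDegree_fill_of_skein C two_pos isUnit_one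
      (Tangle.skein_bigonAntiparallel ε s)).symm
  | three_classical C δ ε h =>
    exact maxKDegree_fill_of_skein C three_pos isUnit_one (Tangle.triSkein_of_triClassical h)
  | three_virtual C δ ε h =>
    exact maxKDegree_fill_of_skein C three_pos isUnit_one (Tangle.triSkein_of_triVirtual δ h)

theorem VirtualLinkDiagram.Equivalent.maxKDegree_eq {K K' : VirtualLinkDiagram}
    (h : VirtualLinkDiagram.Equivalent K K') :
    maxKDegree K.arrowPolynomial = maxKDegree K'.arrowPolynomial := by
  induction h with
  | rel K K' h => exact h.maxKDegree_eq
  | refl K => rfl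
  | symm K K' _ ih => exact ih.symm
  | trans K K' K'' _ _ ih ih' => exact ih.trans ih'

/-! ### The k-degrees of states and the virtual crossing number -/

theorem isWeightedHomogeneous_arrowVar (n : ℕ) :
    MvPolynomial.IsWeightedHomogeneous (fun i : ℕ+ => (i : ℕ)) (arrowVar n) n := by
  unfold arrowVar
  split_ifs with h
  · exact MvPolynomial.isWeightedHomogeneous_X _ _ (⟨n, h⟩ : ℕ+)
  · rw [Nat.eq_zero_of_not_pos h]
    exact MvPolynomial.isWeightedHomogeneous_one _ _

theorem kDegree_eq_weight (m : ℕ+ →₀ ℕ) :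
    kDegree m = Finsupp.weight (fun i : ℕ+ => (i : ℕ)) m := by
  rw [Finsupp.weight_apply, kDegree]
  exact Finsupp.sum_congr fun i _ => by rw [smul_eq_mul, mul_comm]

/-- The monomials of the arrow polynomial come from states, and their k-degrees are the arrow
numbers of the states. -/
theorem DiagramCode.exists_arrowNumber_eq {D : DiagramCode} {m : ℕ+ →₀ ℕ}
    (hm : m ∈ D.arrowPolynomial.support) : ∃ S : D.State, S.arrowNumber = kDegree m := by
  rw [MvPolynomial.mem_support_iff, arrowPolynomial, MvPolynomial.coeff_sum] at hm
  obtain ⟨S, -, hS⟩ := Finset.exists_ne_zero_of_sum_ne_zero hm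
  refine ⟨S, ?_⟩
  have := Fintype.ofFinite S.Loop
  rw [MvPolynomial.coeff_C_mul, finprod_eq_prod_of_fintype] at hS
  have h := MvPolynomial.IsWeightedHomogeneous.prod (w := fun i : ℕ+ => (i : ℕ)) Finset.univ
    (fun C : S.Loop => arrowVar (S.loopArrowNumber C)) (fun C => S.loopArrowNumber C)
    fun C _ => isWeightedHomogeneous_arrowVar _
  rw [State.arrowNumber, finsum_eq_sum_of_fintype, kDegree_eq_weight]
  exact (h (right_ne_zero_of_mul hS)).symm

theorem DiagramCode.State.arrowNumber_le_numVirtual {D : DiagramCode} (hD : D.IsPlanar)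
    (S : D.State) : S.arrowNumber ≤ D.numVirtual := by
  obtain ⟨L, hL, h⟩ := S.exists_labeling_cPairSum_eq
  have h1 := hL.abs_lambdaLinking_le
  rw [← hL.lambdaLinking_comm hD, ← hL.cPairSum_eq, h] at h1
  simpa using h1

theorem VirtualLinkDiagram.maxKDegree_le_numVirtual (K : VirtualLinkDiagram) :
    maxKDegree K.arrowPolynomial ≤ K.numVirtual := by
  refine Finset.sup_le fun m hm => ?_
  obtain ⟨S, hS⟩ := DiagramCode.exists_arrowNumber_eq hm
  rw [← hS]
  exact S.arrowNumber_le_numVirtual K.planar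

theorem VirtualLinkDiagram.maxKDegree_le_virtualCrossingNumber (K : VirtualLinkDiagram) :
    maxKDegree K.arrowPolynomial ≤ K.virtualCrossingNumber := by
  have hne : {n | ∃ K' : VirtualLinkDiagram, Equivalent K K' ∧ K'.numVirtual = n}.Nonempty :=
    ⟨_, K, Relation.EqvGen.refl K, rfl⟩
  obtain ⟨K', hK', h⟩ := Nat.sInf_mem hne
  rw [virtualCrossingNumber, ← h, hK'.maxKDegree_eq]
  exact K'.maxKDegree_le_numVirtual

theorem mainTheorem2 (K : VirtualLinkDiagram) :
    (∀ (S : K.State) (L : K.End → Bool), S.IsLabeling L →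
      (S.lambda L).IsClassical ∧
      (∀ x, (S.lambda L).inLabel (S.lambdaLabel L) (Sum.inl (x, true)) =
          S.lambdaLabel L (Sum.inl (x, false)) ∧
        (S.lambda L).inLabel (S.lambdaLabel L) (Sum.inl (x, false)) =
          S.lambdaLabel L (Sum.inl (x, true))) ∧
      S.lambdaLinking L false true = S.lambdaLinking L true false ∧
      |S.lambdaLinking L false true| ≤ (K.numVirtual : ℤ) ∧
      S.cPairSum L = S.lambdaLinking L false true ∧
      S.cPairSum L ≤ (S.arrowNumber : ℤ)) ∧
    (∀ S : K.State, ∃ L : K.End → Bool, S.IsLabeling L ∧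
      S.cPairSum L = (S.arrowNumber : ℤ) ∧
      |S.lambdaLinking L false true| = (S.arrowNumber : ℤ)) ∧
    maxKDegree K.arrowPolynomial ≤ K.virtualCrossingNumber := by
  refine ⟨fun S L hL => ⟨DiagramCode.State.isClassical_lambda K.planar S L, ?_,
    hL.lambdaLinking_comm K.planar, ?_, hL.cPairSum_eq, hL.cPairSum_le⟩, fun S => ?_,
    K.maxKDegree_le_virtualCrossingNumber⟩
  · rintro ⟨x, hk⟩
    exact ⟨(DiagramCode.State.lambda_inLabel_inl hk true).trans (hL.keeps_label hk true),
      (DiagramCode.State.lambda_inLabel_inl hk false).trans (hL.keeps_label hk false)⟩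
  · rw [hL.lambdaLinking_comm K.planar]
    exact hL.abs_lambdaLinking_le
  · obtain ⟨L, hL, h⟩ := S.exists_labeling_cPairSum_eq
    refine ⟨L, hL, h, ?_⟩
    rw [← hL.cPairSum_eq, h, Nat.abs_cast]
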